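/- Let $E$ be a complex Hilbert space and let $D$ be a (possibly unbounded) self-adjoint operator in $E$ with $\langle Df,f\rangle\ge 0$ for all $f\in\operatorname{dom}D$ (in particular, any self-adjoint positive definite operator). A \emph{spectral representation} of $D$ consists of a measure space $(\Omega,\mu)$, a measurable function $a:\Omega\to[0,\infty)$, a measurable field $(X(p))_{p\in\Omega}$ of Hilbert spaces, and a unitary operator $F$ from $E$ onto the direct integral $X=\int_\Omega X(p)\,d\mu(p)$ such that $f\in\operatorname{dom}D$ if and only if $a\cdot Ff\in X$, and in that case $F(Df)=a\cdot Ff$. Here $X$ is the space of measurable sections $x$ with $\|x\|^2=\int_\Omega\|x(p)\|^2_{X(p)}\,d\mu(p)<\infty$, modulo equality $\mu$-almost everywhere. Then: (1) $D$ has a spectral representation. If $E$ is separable, one can take $\Omega=[0,\infty)$ with a $\sigma$-finite Borel measure $m$ and $a(\lambda)=\lambda$, that is, $X=\int_0^\infty X(\lambda)\,dm(\lambda)$ and $F(Df)(\lambda)=\lambda\,(Ff)(\lambda)$. (2) For a spectral representation of $D$ and $\omega\ge 0$, let $PW_\omega(D)$ be the set of $f\in E$ whose transform $Ff$ has spectral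 support in $[0,\omega]$, i.e. $(Ff)(p)=0$ for $\mu$-almost every $p$ with $a(p)\notin[0,\omega]$. Then for every spectral representation of $D$, every $\omega\ge0$ and every $f\in E$ the following conditions are equivalent: a) $f\in PW_\omega(D)$; b) for every natural number $k$ the vector $f$ belongs to $\operatorname{dom}D^k$ and satisfies the Bernstein inequality $$\|D^kf\|\le\omega^k\|f\|.$$ In particular, $PW_\omega(D)$ does not depend on the spectral representation. -/

import Mathlib

open MeasureTheory
open scoped NNReal

noncomputable section

namespace PaleyWiener

/-! ### Products and powers of unbounded operators -/

section Powers

variable {E : Type*} [AddCommGroup E] [Module ℂ E]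

/-- The product `A B` of two unbounded operators on its natural domain
`{x ∈ dom B | B x ∈ dom A}`. -/
def pmul (A B : E →ₗ.[ℂ] E) : E →ₗ.[ℂ] E where
  domain := (A.domain.comap B.toFun).map B.domain.subtype
  toFun :=
    { toFun := fun x => A ⟨B ⟨x.1, by
          obtain ⟨y, -, hy⟩ := x.2; rw [← hy]; exact y.2⟩, by
          obtain ⟨x, y, hy, rfl⟩ := x; exact hy⟩
      map_add' := by
        rintro ⟨_, x, hx, rfl⟩ ⟨_, y, hy, rfl⟩
        exact (congrArg A (Subtype.ext (B.map_add x y))).trans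
          (A.map_add ⟨B x, hx⟩ ⟨B y, hy⟩)
      map_smul' := by
        rintro c ⟨_, x, hx, rfl⟩
        exact (congrArg A (Subtype.ext (B.map_smul c x))).trans (A.map_smul c ⟨B x, hx⟩) }

/-- The powers `D ^ k` of an unbounded operator on their natural domains:
`D ^ 0` is the identity on the whole space and `D ^ (k + 1) = D D ^ k`. -/
def ppow (D : E →ₗ.[ℂ] E) : ℕ → (E →ₗ.[ℂ] E)
  | 0 => (LinearMap.id : E →ₗ[ℂ] E).toPMap ⊤
  | k + 1 => pmul D (ppow D k)

end Powers

/-! ### Direct integrals of Hilbert spaces -/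

/-- A measurable field structure on a family `X p` of Hilbert spaces: the space of measurable
sections of the family. -/
structure MeasurableField {Ω : Type*} [MeasurableSpace Ω] (X : Ω → Type*)
    [∀ p, NormedAddCommGroup (X p)] [∀ p, InnerProductSpace ℂ (X p)] where
  /-- The measurable sections. -/
  sections : Submodule ℂ (∀ p, X p)
  measurable_norm : ∀ x ∈ sections, Measurable fun p => ‖x p‖
  mem_of_measurable_inner : ∀ y : ∀ p, X p,
    (∀ x ∈ sections, Measurable fun p => inner ℂ (x p) (y p)) → y ∈ sections
  exists_total : ∃ x : ℕ → ∀ p, X p, (∀ n, x n ∈ sections) ∧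
    ∀ p, Dense (Submodule.span ℂ (Set.range fun n => x n p) : Set (X p))

section DirectIntegral

variable {Ω : Type*} [MeasurableSpace Ω] {X : Ω → Type*}
  [∀ p, NormedAddCommGroup (X p)] [∀ p, InnerProductSpace ℂ (X p)]

theorem MeasurableField.measurable_inner (M : MeasurableField X) {x y : ∀ p, X p}
    (hx : x ∈ M.sections) (hy : y ∈ M.sections) :
    Measurable fun p => inner ℂ (x p) (y p) := by
  have h1 := Complex.measurable_ofReal.comp (M.measurable_norm _ (M.sections.add_mem hx hy))
  have h2 := Complex.measurable_ofReal.comp (M.measurable_norm _ (M.sections.sub_mem hx hy))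
  have h3 := Complex.measurable_ofReal.comp
    (M.measurable_norm _ (M.sections.sub_mem hx (M.sections.smul_mem Complex.I hy)))
  have h4 := Complex.measurable_ofReal.comp
    (M.measurable_norm _ (M.sections.add_mem hx (M.sections.smul_mem Complex.I hy)))
  have h := ((h1.pow_const 2).sub (h2.pow_const 2)).add
    (((h3.pow_const 2).sub (h4.pow_const 2)).mul_const Complex.I)
  convert h.div_const 4 using 2 with p
  rw [inner_eq_sum_norm_sq_div_four (𝕜 := ℂ)]
  rfl

/-- The submodule of measurable sections `x` with `∫ ‖x p‖ ^ 2 ∂μ < ∞`. -/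
def sqIntegrableSections (M : MeasurableField X) (μ : Measure Ω) : Submodule ℂ (∀ p, X p) where
  carrier := {x | x ∈ M.sections ∧ MemLp (fun p => ‖x p‖) 2 μ}
  zero_mem' := ⟨M.sections.zero_mem, by simp⟩
  add_mem' := by
    rintro x y ⟨hx, hx'⟩ ⟨hy, hy'⟩
    have h := M.sections.add_mem hx hy
    refine ⟨h, (hx'.add hy').mono (M.measurable_norm _ h).aestronglyMeasurable
      (Filter.Eventually.of_forall fun p => ?_)⟩
    simpa [abs_of_nonneg (add_nonneg (norm_nonneg (x p)) (norm_nonneg (y p)))]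
      using norm_add_le (x p) (y p)
  smul_mem' := by
    rintro c x ⟨hx, hx'⟩
    refine ⟨M.sections.smul_mem c hx, ?_⟩
    simpa [norm_smul] using hx'.const_mul ‖c‖

/-- The space of square integrable measurable sections, as a type of its own carrying the
seminorm `‖x‖ ^ 2 = ∫ ‖x p‖ ^ 2 ∂μ` (and not the product topology). -/
def L2Section (M : MeasurableField X) (μ : Measure Ω) : Type _ :=
  sqIntegrableSections M μ

namespace L2Section

variable {M : MeasurableField X} {μ : Measure Ω}

instance : AddCommGroup (L2Section M μ) := inferInstanceAs (AddCommGroup (sqIntegrableSections M μ))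

instance : Module ℂ (L2Section M μ) := inferInstanceAs (Module ℂ (sqIntegrableSections M μ))

instance : CoeFun (L2Section M μ) fun _ => ∀ p, X p := ⟨fun x => x.1⟩

theorem integrable_inner (x y : L2Section M μ) :
    Integrable (fun p => inner ℂ (x p) (y p)) μ :=
  (MemLp.integrable_mul x.2.2 y.2.2).mono
    (M.measurable_inner x.2.1 y.2.1).aestronglyMeasurable
    (Filter.Eventually.of_forall fun p => by
      simpa using norm_inner_le_norm (𝕜 := ℂ) (x p) (y p))

/-- The semi-inner product `∫ ⟪x p, y p⟫ ∂μ` of square integrable sections. -/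
instance core : PreInnerProductSpace.Core ℂ (L2Section M μ) where
  inner x y := ∫ p, inner ℂ (x p) (y p) ∂μ
  conj_inner_symm x y := by
    rw [← integral_conj]
    exact integral_congr_ae (Filter.Eventually.of_forall fun p => inner_conj_symm (x p) (y p))
  re_inner_nonneg x := by
    have h : RCLike.re (∫ p, inner ℂ (x p) (x p) ∂μ) = ∫ p, RCLike.re (inner ℂ (x p) (x p)) ∂μ :=
      (integral_re (integrable_inner x x)).symm
    rw [h]
    exact integral_nonneg fun p => inner_self_nonneg
  add_left x y z := by
    rw [← integral_add (integrable_inner x z) (integrable_inner y z)]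
    exact integral_congr_ae (Filter.Eventually.of_forall fun p => inner_add_left (x p) (y p) (z p))
  smul_left x y c := by
    rw [← integral_const_mul]
    exact integral_congr_ae (Filter.Eventually.of_forall fun p => inner_smul_left (x p) (y p) c)

instance : SeminormedAddCommGroup (L2Section M μ) :=
  InnerProductSpace.Core.toSeminormedAddCommGroup (𝕜 := ℂ)

instance : InnerProductSpace ℂ (L2Section M μ) := InnerProductSpace.ofCore core

end L2Section

/-- The direct integral `∫ X p dμ(p)`: square integrable measurable sections, where two sections
are identified when their distance is zero, i.e. when they agree almost everywhere. -/
abbrev DirectIntegral (M : MeasurableField X) (μ : Measure Ω) : Type _ :=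
  SeparationQuotient (L2Section M μ)

namespace DirectIntegral

variable {M : MeasurableField X} {μ : Measure Ω}

/-- `y = a x`: multiplication by the scalar function `a`, as a relation between elements of the
direct integral. For given `x` such a `y` exists exactly when `a x` is square integrable. -/
def IsMul (a : Ω → ℝ≥0) (x y : DirectIntegral M μ) : Prop :=
  ∃ s t : L2Section M μ, SeparationQuotient.mk s = x ∧ SeparationQuotient.mk t = y ∧
    ∀ᵐ p ∂μ, t p = ((a p : ℝ) : ℂ) • s p

/-- `x` vanishes almost everywhere outside `S`. -/
def SupportedIn (x : DirectIntegral M μ) (S : Set Ω) : Prop :=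
  ∃ s : L2Section M μ, SeparationQuotient.mk s = x ∧ ∀ᵐ p ∂μ, p ∉ S → s p = 0

end DirectIntegral

end DirectIntegral

/-! ### Spectral representations and Paley-Wiener spaces -/

/-- A spectral representation of an unbounded operator `D` in `E`: a direct integral of Hilbert
spaces over a measure space `(Ω, μ)`, together with a unitary operator `F` from `E` onto it which
carries `D` to the multiplication by a measurable function `a : Ω → [0, ∞)` on its maximal domain.
The classical case is `Ω = [0, ∞)` and `a lam = lam`. -/
structure SpectralRepresentation.{u, w, v} {E : Type u} [NormedAddCommGroup E]
    [InnerProductSpace ℂ E] (D : E →ₗ.[ℂ] E) {Ω : Type w} [MeasurableSpace Ω] (μ : Measure Ω)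
    (a : Ω → ℝ≥0) where
  /-- The fibres of the direct integral. -/
  fiber : Ω → Type v
  [fiberNorm : ∀ p, NormedAddCommGroup (fiber p)]
  [fiberInner : ∀ p, InnerProductSpace ℂ (fiber p)]
  [fiberComplete : ∀ p, CompleteSpace (fiber p)]
  /-- The measurable structure on the fibres. -/
  field : MeasurableField fiber
  measurable_symbol : Measurable a
  /-- The abstract Fourier transform. -/
  F : E ≃ₗᵢ[ℂ] DirectIntegral field μ
  graph_iff : ∀ f g : E, (f, g) ∈ D.graph ↔ DirectIntegral.IsMul a (F f) (F g)

attribute [instance] SpectralRepresentation.fiberNorm SpectralRepresentation.fiberInner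
  SpectralRepresentation.fiberComplete

/-- The Paley-Wiener space `PW_ω(D)`, computed in a spectral representation of `D`: the vectors `f`
whose Fourier transform `F f` has (spectral) support in `[0, ω]`. -/
def SpectralRepresentation.paleyWiener {E : Type*} [NormedAddCommGroup E]
    [InnerProductSpace ℂ E] {D : E →ₗ.[ℂ] E} {Ω : Type*} [MeasurableSpace Ω] {μ : Measure Ω}
    {a : Ω → ℝ≥0} (R : SpectralRepresentation D μ a) (ω : ℝ) : Set E :=
  {f | (R.F f).SupportedIn {p | (a p : ℝ) ∈ Set.Icc 0 ω}}

end PaleyWiener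

end

open MeasureTheory
open scoped NNReal

noncomputable section

/-! Existence. Write `B = (1 + D)⁻¹`. Nonnegativity bounds `1 + D` from below and self-adjointness
makes it onto, so `B` is an injective positive contraction (`exists_isResolvent`). Its continuous
functional calculus on `[0, 1]` represents the continuous functions on `E`; Zorn's lemma splits `E`
into orthogonal cyclic subspaces, each of them an `L²` space of a Riesz measure
(`exists_isHilbertSum`). Injectivity of `B` leaves no mass at `0`, so `z ↦ 1 / z - 1` moves these
measures to `[0, ∞)`, where `B` is multiplication by `1 / (1 + x)` (`exists_halfLine_isometry`), and
hence `D` is multiplication by `x` (`SpectralRepresentation.ofResolvent`). In general the pieces are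
laid side by side on a disjoint union, with fibre `ℂ`. If `E` is separable there are countably many,
and one finite measure `m` dominates all of them; each piece becomes `L²` of `m` restricted to a set
`S i`, and the pieces are stacked over a point `p` into square summable sequences indexed by the `i`
with `p ∈ S i`. Bernstein. `D ^ k` is carried to multiplication by `a ^ k`. If `F f` lives where `a
≤ ω`, the inequality holds pointwise. Conversely, it bounds the moments `∫ a ^ (2k) ‖F f‖²` by `ω ^
(2k) ‖f‖²`; for `η > ω` the mass of `‖F f‖²` on `{a > η}` is then at most `(ω / η) ^ (2k) ‖f‖²`,
which tends to `0` (`ae_eq_zero_of_moments`). -/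

namespace PaleyWiener

/-! ### Powers of unbounded operators through their graphs. -/

section Graph

variable {E : Type*} [AddCommGroup E] [Module ℂ E]

/-- Graphs compose as relations, which lets inductions over powers run without carrying proofs of
domain membership. -/
theorem mem_graph_pmul_iff {A B : E →ₗ.[ℂ] E} {f h : E} :
    (f, h) ∈ (pmul A B).graph ↔ ∃ g, (f, g) ∈ B.graph ∧ (g, h) ∈ A.graph := by
  constructor
  · intro hf
    obtain ⟨⟨x, y, hy, rfl⟩, rfl, rfl⟩ := (LinearPMap.mem_graph_iff _).1 hf
    exact ⟨B y, B.mem_graph y, A.mem_graph ⟨B y, hy⟩⟩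
  · rintro ⟨g, hg, hh⟩
    obtain ⟨y, rfl, rfl⟩ := (LinearPMap.mem_graph_iff _).1 hg
    obtain ⟨z, hz, rfl⟩ := (LinearPMap.mem_graph_iff _).1 hh
    have hy : B y ∈ A.domain := by
      have hz' : (z : E) = B y := hz
      exact hz' ▸ z.2
    refine (LinearPMap.mem_graph_iff _).2 ⟨⟨y, y, hy, rfl⟩, rfl, ?_⟩
    exact congrArg A (Subtype.ext hz.symm)

theorem mem_graph_ppow_zero_iff {D : E →ₗ.[ℂ] E} {f g : E} :
    (f, g) ∈ (ppow D 0).graph ↔ g = f := by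
  constructor
  · intro h
    obtain ⟨x, rfl, rfl⟩ := (LinearPMap.mem_graph_iff _).1 h
    rfl
  · rintro rfl
    exact (LinearPMap.mem_graph_iff _).2 ⟨⟨g, trivial⟩, rfl, rfl⟩

end Graph

/-! ### Calculus in direct integrals. -/

section DirectIntegral

variable {Ω : Type*} [MeasurableSpace Ω] {X : Ω → Type*}
  [∀ p, NormedAddCommGroup (X p)] [∀ p, InnerProductSpace ℂ (X p)]

/-- The maximality axiom of a measurable field upgrades closure under constants to closure under
measurable scalar functions. -/
theorem MeasurableField.smul_mem (M : MeasurableField X) {x : ∀ p, X p} (hx : x ∈ M.sections)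
    {c : Ω → ℂ} (hc : Measurable c) : (fun p => c p • x p) ∈ M.sections :=
  M.mem_of_measurable_inner _ fun y hy => by
    simp only [inner_smul_right]
    exact hc.mul (M.measurable_inner hy hx)

namespace L2Section

variable {M : MeasurableField X} {μ : Measure Ω}

/-- A measurable section with square integrable norm, as an element of `L2Section`. -/
def of (x : ∀ p, X p) (hx : x ∈ M.sections) (hx' : MemLp (fun p => ‖x p‖) 2 μ) :
    L2Section M μ := ⟨x, hx, hx'⟩

theorem measurable_norm (s : L2Section M μ) : Measurable fun p => ‖s p‖ :=
  M.measurable_norm _ s.2.1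

theorem integrable_norm_sq (s : L2Section M μ) : Integrable (fun p => ‖s p‖ ^ 2) μ :=
  s.2.2.integrable_sq

theorem norm_sq_eq (s : L2Section M μ) : ‖s‖ ^ 2 = ∫ p, ‖s p‖ ^ 2 ∂μ := by
  rw [← inner_self_eq_norm_sq (𝕜 := ℂ) s]
  change RCLike.re (∫ p, inner ℂ (s p) (s p) ∂μ) = _
  have h : RCLike.re (∫ p, inner ℂ (s p) (s p) ∂μ) = ∫ p, RCLike.re (inner ℂ (s p) (s p)) ∂μ :=
    (integral_re (integrable_inner s s)).symm
  rw [h]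
  simp only [inner_self_eq_norm_sq]

theorem norm_eq_zero_iff (s : L2Section M μ) : ‖s‖ = 0 ↔ ∀ᵐ p ∂μ, s p = 0 := by
  rw [← sq_eq_zero_iff, norm_sq_eq,
    integral_eq_zero_iff_of_nonneg (fun p => sq_nonneg _) s.integrable_norm_sq]
  refine Filter.eventually_congr (Filter.Eventually.of_forall fun p => ?_)
  simp

theorem mk_eq_mk_iff (s t : L2Section M μ) :
    (SeparationQuotient.mk s : DirectIntegral M μ) = SeparationQuotient.mk t ↔
      ∀ᵐ p ∂μ, s p = t p := by
  rw [← sub_eq_zero, ← SeparationQuotient.mk_sub, ← norm_eq_zero, SeparationQuotient.norm_mk,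
    norm_eq_zero_iff]
  refine Filter.eventually_congr (Filter.Eventually.of_forall fun p => ?_)
  exact sub_eq_zero

/-- The product of a square integrable section and a measurable function which is bounded on the
support of the section. -/
theorem exists_smul (s : L2Section M μ) {c : Ω → ℂ} (hc : Measurable c) {C : ℝ}
    (hC : ∀ᵐ p ∂μ, ‖c p • s p‖ ≤ C * ‖s p‖) :
    ∃ t : L2Section M μ, ∀ p, t p = c p • s p := by
  have h := M.smul_mem s.2.1 hc
  refine ⟨of _ h ((s.2.2.const_mul C).mono (M.measurable_norm _ h).aestronglyMeasurable ?_),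
    fun p => rfl⟩
  filter_upwards [hC] with p hp
  simpa using hp.trans (le_abs_self _)

theorem norm_le_mul {s t : L2Section M μ} {C : ℝ} (hC : 0 ≤ C)
    (h : ∀ᵐ p ∂μ, ‖t p‖ ≤ C * ‖s p‖) : ‖t‖ ≤ C * ‖s‖ := by
  refine le_of_sq_le_sq ?_ (by positivity)
  rw [mul_pow, norm_sq_eq, norm_sq_eq, ← integral_const_mul]
  refine integral_mono_ae t.integrable_norm_sq (s.integrable_norm_sq.const_mul _) ?_
  filter_upwards [h] with p hp
  rw [← mul_pow]
  exact pow_le_pow_left₀ (norm_nonneg _) hp 2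

end L2Section

namespace DirectIntegral

variable {M : MeasurableField X} {μ : Measure Ω} {a c : Ω → ℝ≥0}

/-- Two representatives of a class agree almost everywhere, so the existential in the definition may
be tested on any of them. -/
theorem isMul_mk_iff (s t : L2Section M μ) :
    IsMul a (SeparationQuotient.mk s : DirectIntegral M μ) (SeparationQuotient.mk t) ↔
      ∀ᵐ p ∂μ, t p = ((a p : ℝ) : ℂ) • s p := by
  constructor
  · rintro ⟨s', t', hs, ht, h⟩
    filter_upwards [(L2Section.mk_eq_mk_iff _ _).1 hs, (L2Section.mk_eq_mk_iff _ _).1 ht, h]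
      with p h1 h2 h3
    rw [← h1, ← h2, h3]
  · exact fun h => ⟨s, t, rfl, rfl, h⟩

theorem supportedIn_mk_iff (s : L2Section M μ) (S : Set Ω) :
    SupportedIn (SeparationQuotient.mk s : DirectIntegral M μ) S ↔ ∀ᵐ p ∂μ, p ∉ S → s p = 0 := by
  constructor
  · rintro ⟨s', hs, h⟩
    filter_upwards [(L2Section.mk_eq_mk_iff _ _).1 hs, h] with p h1 h2
    rwa [← h1]
  · exact fun h => ⟨s, rfl, h⟩

theorem IsMul.comp {x y z : DirectIntegral M μ} (hxy : IsMul c x y) (hyz : IsMul a y z) :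
    IsMul (fun p => a p * c p) x z := by
  obtain ⟨s, rfl⟩ := SeparationQuotient.surjective_mk x
  obtain ⟨t, rfl⟩ := SeparationQuotient.surjective_mk y
  obtain ⟨r, rfl⟩ := SeparationQuotient.surjective_mk z
  rw [isMul_mk_iff] at *
  filter_upwards [hxy, hyz] with p h1 h2
  rw [h2, h1, smul_smul]
  push_cast
  rfl

end DirectIntegral

end DirectIntegral

/-! ### Paley-Wiener vectors and the Bernstein inequality. -/

section Bernstein

variable {E : Type*} [NormedAddCommGroup E] [InnerProductSpace ℂ E] {D : E →ₗ.[ℂ] E}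
  {Ω : Type*} [MeasurableSpace Ω] {μ : Measure Ω} {a : Ω → ℝ≥0}

namespace SpectralRepresentation

/-- This direction suffices: for Paley-Wiener vectors, where the converse is wanted, the powers are
constructed by hand. -/
theorem isMul_pow_of_mem_graph_ppow (R : SpectralRepresentation D μ a) {k : ℕ} {f g : E}
    (h : (f, g) ∈ (ppow D k).graph) :
    DirectIntegral.IsMul (fun p => a p ^ k) (R.F f) (R.F g) := by
  induction k generalizing g with
  | zero =>
    rw [mem_graph_ppow_zero_iff] at h
    obtain ⟨s, hs⟩ := SeparationQuotient.surjective_mk (R.F f)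
    exact ⟨s, s, hs, h ▸ hs, by simp⟩
  | succ k ih =>
    obtain ⟨g', h1, h2⟩ := mem_graph_pmul_iff.1 h
    simpa only [pow_succ'] using (ih h1).comp ((R.graph_iff _ _).1 h2)

theorem exists_of_mem_paleyWiener (R : SpectralRepresentation D μ a) {ω : ℝ} (hω : 0 ≤ ω) {f : E}
    (hf : f ∈ R.paleyWiener ω) (k : ℕ) :
    ∃ hf : f ∈ (ppow D k).domain, ‖ppow D k ⟨f, hf⟩‖ ≤ ω ^ k * ‖f‖ := by
  obtain ⟨s, hs, hsupp⟩ := hf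
  have hbound : ∀ k : ℕ, ∀ᵐ p ∂μ, ‖(((a p : ℝ) : ℂ) ^ k) • s p‖ ≤ ω ^ k * ‖s p‖ := by
    intro k
    filter_upwards [hsupp] with p hp
    by_cases h : (a p : ℝ) ≤ ω
    · rw [norm_smul, norm_pow, Complex.norm_real, NNReal.norm_eq]
      gcongr
    · rw [hp fun h' => h h'.2]
      simp
  have hmeas : Measurable fun p => ((a p : ℝ) : ℂ) :=
    Complex.measurable_ofReal.comp R.measurable_symbol.coe_nnreal_real
  -- All sections `a ^ k • s` are square integrable at once, so consecutive ones are related by `D`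
  -- and the induction below only chains graph relations.
  choose t ht using fun k => s.exists_smul (hmeas.pow_const k) (hbound k)
  have hgraph : ∀ k, (f, R.F.symm (SeparationQuotient.mk (t k))) ∈ (ppow D k).graph := by
    intro k
    induction k with
    | zero =>
      rw [mem_graph_ppow_zero_iff, LinearIsometryEquiv.symm_apply_eq, ← hs,
        L2Section.mk_eq_mk_iff]
      exact Filter.Eventually.of_forall fun p => by simp [ht]
    | succ k ih =>
      refine mem_graph_pmul_iff.2 ⟨_, ih, (R.graph_iff _ _).2 ?_⟩
      rw [LinearIsometryEquiv.apply_symm_apply, LinearIsometryEquiv.apply_symm_apply,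
        DirectIntegral.isMul_mk_iff]
      exact Filter.Eventually.of_forall fun p => by rw [ht, ht, smul_smul, pow_succ']
  obtain ⟨x, hx, hx'⟩ := (LinearPMap.mem_graph_iff _).1 (hgraph k)
  obtain rfl : (x : E) = f := hx
  refine ⟨x.2, ?_⟩
  change ‖ppow D k x‖ ≤ _
  have h1 : ‖ppow D k x‖ = ‖t k‖ := by
    rw [hx', LinearIsometryEquiv.norm_map, SeparationQuotient.norm_mk]
  have h2 : ‖(x : E)‖ = ‖s‖ := by
    rw [← R.F.norm_map, ← hs, SeparationQuotient.norm_mk]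
  rw [h1, h2]
  refine L2Section.norm_le_mul (by positivity) ?_
  filter_upwards [hbound k] with p hp
  rwa [ht]

/-- A nonnegative function of finite mass whose moments against a larger weight are bounded by
`ω ^ (2 * k)` vanishes where the weight exceeds `ω`. -/
theorem ae_eq_zero_of_moments {φ : Ω → ℝ} (hφ : ∀ p, 0 ≤ φ p)
    (ha : Measurable a) {ω C : ℝ} (hω : 0 ≤ ω)
    (hint : ∀ k : ℕ, Integrable (fun p => (a p : ℝ) ^ (2 * k) * φ p) μ)
    (hle : ∀ k : ℕ, ∫ p, (a p : ℝ) ^ (2 * k) * φ p ∂μ ≤ ω ^ (2 * k) * C) :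
    ∀ᵐ p ∂μ, ω < a p → φ p = 0 := by
  have hφi : Integrable φ μ := by simpa using hint 0
  -- A gap above `ω` makes the ratio `ω / η` strictly less than one; countably many gaps exhaust `{ω
  -- < a}`.
  have key : ∀ n : ℕ, ∀ᵐ p ∂μ, ω + 1 / (n + 1 : ℝ) < a p → φ p = 0 := by
    intro n
    set η : ℝ := ω + 1 / (n + 1 : ℝ) with hη
    have hηω : ω < η := by
      have : (0 : ℝ) < 1 / (n + 1 : ℝ) := by positivity
      linarith
    have hη0 : 0 < η := hω.trans_lt hηω
    have hS : MeasurableSet {p | η < (a p : ℝ)} :=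
      measurableSet_lt measurable_const ha.coe_nnreal_real
    have h1 : ∀ k : ℕ, ∫ p in {p | η < (a p : ℝ)}, φ p ∂μ ≤ ((ω / η) ^ 2) ^ k * C := by
      intro k
      -- Chebyshev's inequality for the weight `a ^ (2 * k)`.
      have h2 : η ^ (2 * k) * ∫ p in {p | η < (a p : ℝ)}, φ p ∂μ ≤ ω ^ (2 * k) * C := by
        refine le_trans ?_ (hle k)
        rw [← integral_const_mul]
        refine le_trans (setIntegral_mono_on (hφi.integrableOn.const_mul _)
          (hint k).integrableOn hS fun p hp => ?_)
          (setIntegral_le_integral (hint k) (Filter.Eventually.of_forall fun p => ?_))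
        · have : η < (a p : ℝ) := hp
          have := hφ p
          gcongr
        · have := hφ p
          positivity
      rw [← pow_mul, div_pow, div_mul_eq_mul_div, le_div_iff₀ (by positivity), mul_comm]
      exact h2
    have h3 : Filter.Tendsto (fun k : ℕ => ((ω / η) ^ 2) ^ k * C) Filter.atTop (nhds (0 * C)) := by
      refine (tendsto_pow_atTop_nhds_zero_of_lt_one (by positivity) ?_).mul_const C
      exact pow_lt_one₀ (by positivity) ((div_lt_one hη0).2 hηω) two_ne_zero
    have h4 : ∫ p in {p | η < (a p : ℝ)}, φ p ∂μ = 0 := by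
      refine le_antisymm ?_ (setIntegral_nonneg hS fun p _ => hφ p)
      have := ge_of_tendsto' h3 h1
      simpa using this
    rw [setIntegral_eq_zero_iff_of_nonneg_ae (Filter.Eventually.of_forall hφ)
      hφi.integrableOn] at h4
    exact (ae_restrict_iff' hS).1 h4
  filter_upwards [ae_all_iff.2 key] with p hp h
  obtain ⟨n, hn⟩ := exists_nat_one_div_lt (sub_pos.2 h)
  exact hp n (by linarith)

/-- The squared Bernstein inequality for `D ^ k` is a bound on the moment of order `2 * k` of `‖F
f‖²` with respect to `a`. -/
theorem mem_paleyWiener_of_bernstein (R : SpectralRepresentation D μ a) {ω : ℝ} (hω : 0 ≤ ω)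
    {f : E} (hf : ∀ k : ℕ, ∃ hf : f ∈ (ppow D k).domain, ‖ppow D k ⟨f, hf⟩‖ ≤ ω ^ k * ‖f‖) :
    f ∈ R.paleyWiener ω := by
  obtain ⟨s, hs⟩ := SeparationQuotient.surjective_mk (R.F f)
  have hnorm : ‖f‖ = ‖s‖ := by rw [← R.F.norm_map, ← hs, SeparationQuotient.norm_mk]
  have key : ∀ k : ℕ, Integrable (fun p => (a p : ℝ) ^ (2 * k) * ‖s p‖ ^ 2) μ ∧
      ∫ p, (a p : ℝ) ^ (2 * k) * ‖s p‖ ^ 2 ∂μ ≤ ω ^ (2 * k) * ‖s‖ ^ 2 := by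
    intro k
    obtain ⟨hk, hle⟩ := hf k
    obtain ⟨t, ht⟩ := SeparationQuotient.surjective_mk (R.F (ppow D k ⟨f, hk⟩))
    have h := R.isMul_pow_of_mem_graph_ppow ((ppow D k).mem_graph ⟨f, hk⟩)
    rw [← ht] at h
    change DirectIntegral.IsMul _ (R.F f) _ at h
    rw [← hs, DirectIntegral.isMul_mk_iff] at h
    have heq : (fun p => ‖t p‖ ^ 2) =ᵐ[μ] fun p => (a p : ℝ) ^ (2 * k) * ‖s p‖ ^ 2 := by
      filter_upwards [h] with p hp
      rw [hp, norm_smul, Complex.norm_real, NNReal.norm_eq, mul_pow, NNReal.coe_pow, ← pow_mul,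
        mul_comm k]
    refine ⟨t.integrable_norm_sq.congr heq, ?_⟩
    rw [← integral_congr_ae heq, ← L2Section.norm_sq_eq, mul_comm 2, pow_mul, ← mul_pow]
    refine pow_le_pow_left₀ (norm_nonneg _) ?_ 2
    rwa [← hnorm, ← SeparationQuotient.norm_mk, ht, R.F.norm_map]
  have h0 := ae_eq_zero_of_moments (φ := fun p => ‖s p‖ ^ 2) (fun p => sq_nonneg _)
    R.measurable_symbol hω (fun k => (key k).1)
    (fun k => (key k).2)
  change DirectIntegral.SupportedIn _ _
  rw [← hs, DirectIntegral.supportedIn_mk_iff]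
  filter_upwards [h0] with p hp hn
  have : ω < a p := not_le.1 fun h => hn ⟨(a p).2, h⟩
  simpa using hp this

/-- In every spectral representation, the Paley-Wiener space consists of the vectors satisfying the
Bernstein inequality. -/
theorem mem_paleyWiener_iff (R : SpectralRepresentation D μ a) {ω : ℝ} (hω : 0 ≤ ω) (f : E) :
    f ∈ R.paleyWiener ω ↔
      ∀ k : ℕ, ∃ hf : f ∈ (ppow D k).domain, ‖ppow D k ⟨f, hf⟩‖ ≤ ω ^ k * ‖f‖ :=
  ⟨R.exists_of_mem_paleyWiener hω, R.mem_paleyWiener_of_bernstein hω⟩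

end SpectralRepresentation

end Bernstein

/-! ### The resolvent of a nonnegative self-adjoint operator. -/

section Resolvent

variable {E : Type*} [NormedAddCommGroup E] [InnerProductSpace ℂ E]

/-- `B` is the resolvent `(1 + D)⁻¹`. -/
def IsResolvent (D : E →ₗ.[ℂ] E) (B : E →L[ℂ] E) : Prop :=
  ∀ f g : E, (f, g) ∈ D.graph ↔ B (f + g) = f

theorem IsResolvent.injective {D : E →ₗ.[ℂ] E} {B : E →L[ℂ] E} (h : IsResolvent D B) {x : E}
    (hx : B x = 0) : x = 0 := by
  have h1 : ((0 : E), x) ∈ D.graph := (h 0 x).2 (by simpa using hx)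
  exact D.graph_fst_eq_zero_snd h1 rfl

/-- The map `(x, D x) ↦ x + D x` on the graph of `D`. -/
def graphSum (D : E →ₗ.[ℂ] E) : D.graph →ₗ[ℂ] E :=
  (LinearMap.fst ℂ E E + LinearMap.snd ℂ E E) ∘ₗ D.graph.subtype

theorem graphSum_apply (D : E →ₗ.[ℂ] E) (z : D.graph) : graphSum D z = z.1.1 + z.1.2 := rfl

/-- In the expansion of `‖x + D x‖²` the cross term is nonnegative. The graph carries the maximum
norm of the product, so each component is bounded separately. -/
theorem norm_le_norm_graphSum {D : E →ₗ.[ℂ] E}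
    (hpos : ∀ x : D.domain, 0 ≤ (inner ℂ (D x) (x : E)).re) (z : D.graph) :
    ‖z‖ ≤ ‖graphSum D z‖ := by
  obtain ⟨⟨_, _⟩, hz⟩ := z
  obtain ⟨x, rfl, rfl⟩ := (LinearPMap.mem_graph_iff _).1 hz
  rw [graphSum_apply]
  change ‖((x : E), D x)‖ ≤ ‖(x : E) + D x‖
  have h : ‖(x : E) + D x‖ ^ 2 = ‖(x : E)‖ ^ 2 + 2 * (inner ℂ (D x) (x : E)).re + ‖D x‖ ^ 2 := by
    rw [norm_add_sq (𝕜 := ℂ), inner_re_symm]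
    rfl
  have h' := hpos x
  rw [Prod.norm_def]
  refine max_le (le_of_sq_le_sq ?_ (norm_nonneg _)) (le_of_sq_le_sq ?_ (norm_nonneg _)) <;>
  · rw [h]
    change ‖_‖ ^ 2 ≤ _
    nlinarith [sq_nonneg ‖(x : E)‖, sq_nonneg ‖D x‖]

variable [CompleteSpace E]

/-- The graph is complete and the map is bounded below, so the range is closed. A vector `y`
orthogonal to it lies in the domain of the adjoint, which is `D`, with `D y = -y`; nonnegativity
then forces `y = 0`. -/
theorem range_graphSum {D : E →ₗ.[ℂ] E} (hD : IsSelfAdjoint D)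
    (hpos : ∀ x : D.domain, 0 ≤ (inner ℂ (D x) (x : E)).re) :
    LinearMap.range (graphSum D) = ⊤ := by
  have hcl : IsClosed (LinearMap.range (graphSum D) : Set E) := by
    have : CompleteSpace D.graph := hD.isClosed.completeSpace_coe
    have ha : AntilipschitzWith 1 (graphSum D) :=
      AddMonoidHomClass.antilipschitz_of_bound _ fun z => by
        simpa using norm_le_norm_graphSum hpos z
    have hc : UniformContinuous (graphSum D) := by
      have : Continuous (graphSum D) := by
        change Continuous fun z : D.graph => z.1.1 + z.1.2
        fun_prop
      exact uniformContinuous_addMonoidHom_of_continuous this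
    rw [LinearMap.coe_range]
    exact ha.isClosed_range hc
  have : CompleteSpace (LinearMap.range (graphSum D)) := hcl.completeSpace_coe
  rw [← Submodule.orthogonal_eq_bot_iff, Submodule.eq_bot_iff]
  intro y hy
  rw [Submodule.mem_orthogonal] at hy
  have h1 : ∀ x : D.domain, inner ℂ (-y) (x : E) = inner ℂ y (D x) := by
    intro x
    have h := hy _ ⟨⟨_, D.mem_graph x⟩, rfl⟩
    rw [graphSum_apply, inner_eq_zero_symm] at h
    change inner ℂ y ((x : E) + D x) = 0 at h
    rw [inner_add_right] at h
    rw [inner_neg_left]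
    linear_combination -h
  have hDD : LinearPMap.adjoint D = D := LinearPMap.isSelfAdjoint_def.1 hD
  have hmem : y ∈ (LinearPMap.adjoint D).domain :=
    LinearPMap.mem_adjoint_domain_of_exists y ⟨-y, h1⟩
  have happ := LinearPMap.adjoint_apply_eq hD.dense_domain ⟨y, hmem⟩ h1
  have hg : (y, -y) ∈ (LinearPMap.adjoint D).graph :=
    (LinearPMap.mem_graph_iff _).2 ⟨⟨y, hmem⟩, rfl, happ⟩
  rw [hDD] at hg
  obtain ⟨x, hx, hx'⟩ := (LinearPMap.mem_graph_iff _).1 hg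
  have h2 := hpos x
  change (x : E) = y at hx
  change D x = -y at hx'
  rw [hx, hx', inner_neg_left, Complex.neg_re] at h2
  have h3 : (inner ℂ y y).re = ‖y‖ ^ 2 := inner_self_eq_norm_sq (𝕜 := ℂ) y
  rw [h3] at h2
  have : ‖y‖ = 0 := by
    have := sq_nonneg ‖y‖
    exact pow_eq_zero_iff two_ne_zero |>.1 (by linarith)
  exact norm_eq_zero.1 this

/-- A nonnegative self-adjoint operator has a resolvent at `-1`, which is a positive contraction. -/
theorem exists_isResolvent {D : E →ₗ.[ℂ] E} (hD : IsSelfAdjoint D)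
    (hpos : ∀ x : D.domain, 0 ≤ (inner ℂ (D x) (x : E)).re) :
    ∃ B : E →L[ℂ] E, B.IsPositive ∧ ‖B‖ ≤ 1 ∧ IsResolvent D B := by
  have hinj : Function.Injective (graphSum D) := by
    rw [injective_iff_map_eq_zero]
    intro z hz
    have := norm_le_norm_graphSum hpos z
    rw [hz, norm_zero] at this
    exact norm_le_zero_iff.1 this
  let e : D.graph ≃ₗ[ℂ] E :=
    LinearEquiv.ofBijective (graphSum D) ⟨hinj, LinearMap.range_eq_top.1 (range_graphSum hD hpos)⟩
  have he : ∀ u, (e.symm u).1.1 + (e.symm u).1.2 = u := fun u => e.apply_symm_apply u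
  -- `B₀ u` is the unique `x` with `x + D x = u`.
  let B₀ : E →ₗ[ℂ] E := LinearMap.fst ℂ E E ∘ₗ D.graph.subtype ∘ₗ e.symm.toLinearMap
  have hB₀ : ∀ u, ‖B₀ u‖ ≤ 1 * ‖u‖ := by
    intro u
    rw [one_mul]
    refine (norm_fst_le (e.symm u).1).trans ((norm_le_norm_graphSum hpos (e.symm u)).trans ?_)
    exact (congrArg norm (e.apply_symm_apply u)).le
  have hgr : ∀ u, ∃ x : D.domain, B₀ u = x ∧ (x : E) + D x = u := by
    intro u
    obtain ⟨x, hx, hx'⟩ := (LinearPMap.mem_graph_iff _).1 (e.symm u).2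
    exact ⟨x, hx.symm, by rw [hx, hx', he]⟩
  have hsymm : ∀ x y : D.domain, inner ℂ (D x) (y : E) = inner ℂ (x : E) (D y) := by
    have h := LinearPMap.adjoint_isFormalAdjoint hD.dense_domain
    rw [LinearPMap.isSelfAdjoint_def.1 hD] at h
    exact h
  refine ⟨B₀.mkContinuous 1 hB₀, ⟨?_, ?_⟩, LinearMap.mkContinuous_norm_le _ zero_le_one _, ?_⟩
  · intro u w
    obtain ⟨x, hx, hu⟩ := hgr u
    obtain ⟨y, hy, hw⟩ := hgr w
    change inner ℂ (B₀ u) w = inner ℂ u (B₀ w)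
    rw [hx, hy, ← hu, ← hw, inner_add_left, inner_add_right, hsymm]
  · intro u
    obtain ⟨x, hx, hu⟩ := hgr u
    change 0 ≤ RCLike.re (inner ℂ (B₀ u) u)
    rw [hx, ← hu, inner_add_right, map_add, inner_self_eq_norm_sq, ← hsymm]
    exact add_nonneg (sq_nonneg _) (hpos x)
  · intro f g
    change _ ↔ B₀ (f + g) = f
    constructor
    · intro h
      have : e.symm (f + g) = ⟨(f, g), h⟩ := e.symm_apply_eq.2 rfl
      change (e.symm (f + g)).1.1 = f
      rw [this]
    · intro h
      have h1 : (e.symm (f + g)).1.1 = f := h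
      have h2 := he (f + g)
      rw [h1, add_left_cancel_iff] at h2
      have : (e.symm (f + g)).1 = (f, g) := Prod.ext h1 h2
      exact this ▸ (e.symm (f + g)).2

end Resolvent

/-! ### Recovering the operator from its diagonalized resolvent. -/

section OfResolvent

variable {E : Type*} [NormedAddCommGroup E] [InnerProductSpace ℂ E] {D : E →ₗ.[ℂ] E}
  {Ω : Type*} [MeasurableSpace Ω] {μ : Measure Ω} {a : Ω → ℝ≥0}

/-- The function `1 / (1 + x)`. -/
def resolventSymbol (x : ℝ≥0) : ℂ := ((1 + (x : ℝ) : ℝ) : ℂ)⁻¹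

theorem measurable_resolventSymbol : Measurable resolventSymbol := by
  unfold resolventSymbol
  fun_prop

theorem norm_resolventSymbol_le (x : ℝ≥0) : ‖resolventSymbol x‖ ≤ 1 := by
  rw [resolventSymbol, norm_inv, Complex.norm_real, Real.norm_of_nonneg (by positivity)]
  exact inv_le_one_of_one_le₀ (by simp)

/-- A unitary operator onto a direct integral which diagonalizes the resolvent of `D` is a spectral
representation of `D`. -/
def SpectralRepresentation.ofResolvent {B : E →L[ℂ] E} (hB : IsResolvent D B)
    {X : Ω → Type*} [∀ p, NormedAddCommGroup (X p)] [∀ p, InnerProductSpace ℂ (X p)]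
    [∀ p, CompleteSpace (X p)] (M : MeasurableField X) (ha : Measurable a)
    (F : E ≃ₗᵢ[ℂ] DirectIntegral M μ)
    (hF : ∀ s t : L2Section M μ, (∀ p, t p = resolventSymbol (a p) • s p) →
      B (F.symm (SeparationQuotient.mk s)) = F.symm (SeparationQuotient.mk t)) :
    SpectralRepresentation D μ a where
  fiber := X
  field := M
  measurable_symbol := ha
  F := F
  graph_iff f g := by
    obtain ⟨s, hs⟩ := SeparationQuotient.surjective_mk (F f)
    obtain ⟨t, ht⟩ := SeparationQuotient.surjective_mk (F g)
    have hfg : f + g = F.symm (SeparationQuotient.mk (s + t)) := by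
      rw [LinearIsometryEquiv.eq_symm_apply, map_add, ← hs, ← ht, SeparationQuotient.mk_add]
    obtain ⟨r, hr⟩ := (s + t).exists_smul (measurable_resolventSymbol.comp ha) (C := 1)
      (Filter.Eventually.of_forall fun p => by
        rw [norm_smul]
        exact mul_le_mul_of_nonneg_right (norm_resolventSymbol_le _) (norm_nonneg _))
    -- The graph condition `B (f + g) = f` becomes `(s + t) / (1 + a) = s` almost everywhere, which
    -- is `t = a s`.
    rw [hB, hfg, hF _ r hr, LinearIsometryEquiv.symm_apply_eq, ← hs, ← ht,
      L2Section.mk_eq_mk_iff, DirectIntegral.isMul_mk_iff]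
    refine Filter.eventually_congr (Filter.Eventually.of_forall fun p => ?_)
    have hne : ((1 + (a p : ℝ) : ℝ) : ℂ) ≠ 0 := by
      rw [Complex.ofReal_ne_zero]
      positivity
    rw [hr]
    change resolventSymbol (a p) • (s p + t p) = s p ↔ _
    rw [resolventSymbol, inv_smul_eq_iff₀ hne, Complex.ofReal_add, Complex.ofReal_one, add_smul,
      one_smul, add_left_cancel_iff]

end OfResolvent

/-! ### Cyclic decomposition of representations of `C(X, ℂ)`. -/

section Cyclic

open scoped CompactlySupported

variable {E : Type*} [NormedAddCommGroup E] [InnerProductSpace ℂ E]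

/-- The isometry `V` carries the multiplication by `φ` to the operator `B`. -/
def Intertwines {X : Type*} [MeasurableSpace X] {ν : Measure X} (φ : X → ℂ) (B : E →L[ℂ] E)
    (V : Lp ℂ 2 ν →ₗᵢ[ℂ] E) : Prop :=
  ∀ g h : Lp ℂ 2 ν, (h =ᵐ[ν] fun x => φ x * g x) → V h = B (V g)

variable [CompleteSpace E] {X : Type*} [TopologicalSpace X]

/-- A real continuous function, regarded as a complex one. -/
def ofRealMap (f : C(X, ℝ)) : C(X, ℂ) := ⟨fun x => (f x : ℂ), by fun_prop⟩

theorem inner_starHom (Φ : C(X, ℂ) →⋆ₐ[ℂ] (E →L[ℂ] E)) (f g : C(X, ℂ)) (v w : E) :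
    inner ℂ (Φ f v) (Φ g w) = inner ℂ (Φ (star g * f) v) w := by
  rw [map_mul, map_star, ContinuousLinearMap.star_eq_adjoint, mul_apply_eq_comp,
    ContinuousLinearMap.adjoint_inner_left]

/-- A maximal family of nonzero vectors generating pairwise orthogonal cyclic subspaces. -/
theorem exists_maximal_orthogonal_cyclic (Φ : C(X, ℂ) →⋆ₐ[ℂ] (E →L[ℂ] E)) :
    ∃ S : Set E, (∀ v ∈ S, v ≠ 0) ∧ (S.Pairwise fun v w => ∀ f, inner ℂ (Φ f v) w = 0) ∧
      ∀ w, (∀ v ∈ S, ∀ f, inner ℂ (Φ f v) w = 0) → w = 0 := by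
  obtain ⟨S, hS⟩ := zorn_subset
    {S : Set E | (∀ v ∈ S, v ≠ 0) ∧ S.Pairwise fun v w => ∀ f, inner ℂ (Φ f v) w = 0} (by
      intro c hc hchain
      refine ⟨⋃₀ c, ⟨?_, ?_⟩, fun s hs => Set.subset_sUnion_of_mem hs⟩
      · rintro v ⟨s, hs, hv⟩
        exact (hc hs).1 v hv
      · exact (Set.pairwise_sUnion hchain.directedOn).2 fun s hs => (hc hs).2)
  refine ⟨S, hS.prop.1, hS.prop.2, fun w hw => ?_⟩
  -- A nonzero `w` could be adjoined to `S`, so maximality puts it in `S` already; then `f = 1`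
  -- gives `⟪w, w⟫ = 0`.
  by_contra hw0
  have hmem : w ∈ S := by
    refine hS.le_of_ge ⟨?_, ?_⟩ (Set.subset_insert w S) (Set.mem_insert w S)
    · rintro v (rfl | hv)
      · exact hw0
      · exact hS.prop.1 v hv
    · refine hS.prop.2.insert fun v hv _ => ⟨fun f => ?_, hw v hv⟩
      -- `Φ (star f)` is the adjoint of `Φ f`, which gives orthogonality in the opposite order.
      have h := hw v hv (star f)
      rw [inner_eq_zero_symm, map_star, ContinuousLinearMap.star_eq_adjoint,
        ContinuousLinearMap.adjoint_inner_right] at h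
      exact h
  have h := hw w hmem 1
  rw [map_one, one_apply_eq_self, inner_self_eq_zero] at h
  exact hw0 h

variable [CompactSpace X]

/-- The positive functional `f ↦ ⟪v, Φ f v⟫` of a representation of `C(X, ℂ)`. -/
def vectorFunctional (Φ : C(X, ℂ) →⋆ₐ[ℂ] (E →L[ℂ] E)) (v : E) : C_c(X, ℝ) →ₚ[ℝ] ℝ :=
  PositiveLinearMap.mk₀
    { toFun := fun f => (inner ℂ (Φ (ofRealMap f.toContinuousMap) v) v).re
      map_add' := fun f g => by
        have : ofRealMap (f + g).toContinuousMap =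
            ofRealMap f.toContinuousMap + ofRealMap g.toContinuousMap := by
          ext x
          exact Complex.ofReal_add _ _
        rw [this, map_add, add_apply, inner_add_left, Complex.add_re]
      map_smul' := fun c f => by
        have : ofRealMap (c • f).toContinuousMap = (c : ℂ) • ofRealMap f.toContinuousMap := by
          ext x
          exact Complex.ofReal_mul _ _
        rw [this, map_smul, smul_apply, inner_smul_left, Complex.conj_ofReal,
          Complex.re_ofReal_mul]
        rfl }
    (fun f hf => by
      -- With `f = star r * r` the functional takes the value `‖Φ r v‖²`.
      let r : C(X, ℂ) := ofRealMap ⟨fun x => √(f x), by fun_prop⟩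
      have : ofRealMap f.toContinuousMap = star r * r := by
        ext x
        change ((f x : ℝ) : ℂ) = star ((√(f x) : ℝ) : ℂ) * ((√(f x) : ℝ) : ℂ)
        have hx : (0 : ℝ) ≤ f x := hf x
        rw [Complex.star_def, Complex.conj_ofReal, ← Complex.ofReal_mul, Real.mul_self_sqrt hx]
      change 0 ≤ (inner ℂ (Φ (ofRealMap f.toContinuousMap) v) v).re
      rw [this, ← inner_starHom]
      exact inner_self_nonneg (𝕜 := ℂ))

variable [T2Space X] [MeasurableSpace X] [BorelSpace X]

/-- The spectral measure of a vector for a representation of `C(X, ℂ)`. -/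
def vectorMeasure (Φ : C(X, ℂ) →⋆ₐ[ℂ] (E →L[ℂ] E)) (v : E) : Measure X :=
  RealRMK.rieszMeasure (vectorFunctional Φ v)

instance (Φ : C(X, ℂ) →⋆ₐ[ℂ] (E →L[ℂ] E)) (v : E) : IsFiniteMeasure (vectorMeasure Φ v) :=
  inferInstanceAs (IsFiniteMeasure (RealRMK.rieszMeasure _))

instance (Φ : C(X, ℂ) →⋆ₐ[ℂ] (E →L[ℂ] E)) (v : E) : (vectorMeasure Φ v).Regular :=
  inferInstanceAs (RealRMK.rieszMeasure _).Regular

/-- The integrand is `star f * f`, on which the functional is `⟪Φ f v, Φ f v⟫`. The quadratic form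
is enough, because only an isometry has to be built. -/
theorem integral_vectorMeasure (Φ : C(X, ℂ) →⋆ₐ[ℂ] (E →L[ℂ] E)) (v : E) (f : C(X, ℂ)) :
    ∫ x, ‖f x‖ ^ 2 ∂(vectorMeasure Φ v) = ‖Φ f v‖ ^ 2 := by
  let h : C_c(X, ℝ) := ⟨⟨fun x => ‖f x‖ ^ 2, by fun_prop⟩, HasCompactSupport.of_compactSpace _⟩
  have h1 : ∫ x, ‖f x‖ ^ 2 ∂(vectorMeasure Φ v) = vectorFunctional Φ v h :=
    RealRMK.integral_rieszMeasure (vectorFunctional Φ v) h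
  have h2 : ofRealMap h.toContinuousMap = star f * f := by
    ext x
    change ((‖f x‖ ^ 2 : ℝ) : ℂ) = star (f x) * f x
    rw [Complex.star_def, Complex.conj_mul', Complex.ofReal_pow]
  rw [h1, ← inner_self_eq_norm_sq (𝕜 := ℂ), inner_starHom, ← h2]
  rfl

theorem norm_toLp_vectorMeasure (Φ : C(X, ℂ) →⋆ₐ[ℂ] (E →L[ℂ] E)) (v : E) (f : C(X, ℂ)) :
    ‖ContinuousMap.toLp 2 (vectorMeasure Φ v) ℂ f‖ = ‖Φ f v‖ := by
  have h : ‖ContinuousMap.toLp 2 (vectorMeasure Φ v) ℂ f‖ ^ 2 = ‖Φ f v‖ ^ 2 := by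
    rw [← integral_vectorMeasure, ← inner_self_eq_norm_sq (𝕜 := ℂ), L2.inner_def, ← integral_re
      (L2.integrable_inner _ _)]
    refine integral_congr_ae ?_
    filter_upwards [ContinuousMap.coeFn_toLp (p := 2) (𝕜 := ℂ) (vectorMeasure Φ v) f] with x hx
    rw [hx, inner_self_eq_norm_sq]
  exact (pow_left_inj₀ (norm_nonneg _) (norm_nonneg _) two_ne_zero).1 h

theorem denseRange_toLp_vectorMeasure (Φ : C(X, ℂ) →⋆ₐ[ℂ] (E →L[ℂ] E)) (v : E) :
    DenseRange (ContinuousMap.toLp 2 (vectorMeasure Φ v) ℂ : C(X, ℂ) →L[ℂ] _) :=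
  ContinuousMap.toLp_denseRange ℂ _ ℂ ENNReal.ofNat_ne_top

/-- The isometry from `L²` of the spectral measure of `v` onto the cyclic subspace generated
by `v`. -/
theorem exists_cyclic_isometry (Φ : C(X, ℂ) →⋆ₐ[ℂ] (E →L[ℂ] E)) (v : E) :
    ∃ V : Lp ℂ 2 (vectorMeasure Φ v) →ₗᵢ[ℂ] E,
      (∀ f, V (ContinuousMap.toLp 2 (vectorMeasure Φ v) ℂ f) = Φ f v) ∧
      ∀ f : C(X, ℂ), Intertwines f (Φ f) V := by
  let e : C(X, ℂ) →ₗ[ℂ] Lp ℂ 2 (vectorMeasure Φ v) :=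
    (ContinuousMap.toLp 2 (vectorMeasure Φ v) ℂ).toLinearMap
  have hd : DenseRange e := denseRange_toLp_vectorMeasure Φ v
  let T : C(X, ℂ) →ₗ[ℂ] E :=
    { toFun := fun f => Φ f v
      map_add' := fun f g => by simp
      map_smul' := fun c f => by simp }
  -- Since `e` need not be injective, the equality of norms is also what makes `e f ↦ Φ f v` well
  -- defined.
  have hn : ∀ f, ‖T f‖ = ‖e f‖ := fun f => (norm_toLp_vectorMeasure Φ v f).symm
  have hTe : ∀ f, T.extendOfNorm e (e f) = T f :=
    LinearMap.extendOfNorm_eq hd ⟨1, fun f => by rw [hn, one_mul]⟩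
  let V : Lp ℂ 2 (vectorMeasure Φ v) →ₗᵢ[ℂ] E :=
    { toLinearMap := (T.extendOfNorm e).toLinearMap
      norm_map' := by
        refine hd.induction ?_ (isClosed_eq (by
          change Continuous fun x => ‖T.extendOfNorm e x‖
          fun_prop) continuous_norm)
        rintro _ ⟨f, rfl⟩
        exact (congrArg norm (hTe f)).trans (hn f) }
  have hV : ∀ f, V (ContinuousMap.toLp 2 (vectorMeasure Φ v) ℂ f) = Φ f v := hTe
  refine ⟨V, hV, fun φ g h hgh => ?_⟩
  rw [← sub_eq_zero, ← norm_le_zero_iff]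
  refine le_of_forall_pos_le_add fun ε hε => ?_
  -- Intertwining is exact on continuous functions. Replacing `g` by such an `f` costs at most `(‖φ‖
  -- + ‖Φ φ‖) * ‖g - e f‖`; the added `1` keeps the divisor positive.
  have hK : 0 < ‖φ‖ + ‖Φ φ‖ + 1 := by positivity
  obtain ⟨f, hf⟩ := hd.exists_dist_lt g (div_pos hε hK)
  rw [dist_eq_norm, lt_div_iff₀ hK] at hf
  have h1 : ‖h - e (φ * f)‖ ≤ ‖φ‖ * ‖g - e f‖ := by
    refine Lp.norm_le_mul_norm_of_ae_le_mul ?_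
    filter_upwards [hgh, ContinuousMap.coeFn_toLp (p := 2) (𝕜 := ℂ) (vectorMeasure Φ v) (φ * f),
      ContinuousMap.coeFn_toLp (p := 2) (𝕜 := ℂ) (vectorMeasure Φ v) f,
      Lp.coeFn_sub h (e (φ * f)), Lp.coeFn_sub g (e f)] with x h1 h2 h3 h4 h5
    rw [h4, h5, Pi.sub_apply, Pi.sub_apply, h1]
    change ‖φ x * g x - (ContinuousMap.toLp 2 (vectorMeasure Φ v) ℂ (φ * f)) x‖ ≤
      ‖φ‖ * ‖g x - (ContinuousMap.toLp 2 (vectorMeasure Φ v) ℂ f) x‖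
    rw [h2, h3, ContinuousMap.mul_apply, ← mul_sub, norm_mul]
    gcongr
    exact φ.norm_coe_le_norm x
  have h2 : V h - Φ φ (V g) = V (h - e (φ * f)) - Φ φ (V (g - e f)) := by
    have h3 : V (e (φ * f)) = Φ (φ * f) v := hV _
    have h4 : V (e f) = Φ f v := hV _
    rw [map_sub, map_sub, map_sub, h3, h4, map_mul, mul_apply_eq_comp]
    abel
  rw [h2, zero_add]
  calc _ ≤ ‖V (h - e (φ * f))‖ + ‖Φ φ (V (g - e f))‖ := norm_sub_le _ _
    _ ≤ ‖φ‖ * ‖g - e f‖ + ‖Φ φ‖ * ‖g - e f‖ := by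
        refine add_le_add (by rwa [V.norm_map]) (((Φ φ).le_opNorm _).trans_eq ?_)
        rw [V.norm_map]
    _ ≤ ε := by nlinarith [norm_nonneg (g - e f)]

/-- On generators, `⟪Φ f' v, Φ f w⟫ = ⟪Φ (star f * f') v, w⟫ = 0`; density of the continuous
functions is then used in each argument. -/
theorem inner_eq_zero_of_cyclic {Φ : C(X, ℂ) →⋆ₐ[ℂ] (E →L[ℂ] E)} {v w : E}
    {V : Lp ℂ 2 (vectorMeasure Φ v) →ₗᵢ[ℂ] E} {W : Lp ℂ 2 (vectorMeasure Φ w) →ₗᵢ[ℂ] E}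
    (hV : ∀ f, V (ContinuousMap.toLp 2 (vectorMeasure Φ v) ℂ f) = Φ f v)
    (hW : ∀ f, W (ContinuousMap.toLp 2 (vectorMeasure Φ w) ℂ f) = Φ f w)
    (hvw : ∀ f, inner ℂ (Φ f v) w = 0) (g : Lp ℂ 2 (vectorMeasure Φ v))
    (h : Lp ℂ 2 (vectorMeasure Φ w)) : inner ℂ (V g) (W h) = 0 := by
  have h1 : ∀ f g, inner ℂ (V g) (Φ f w) = 0 := by
    intro f
    refine (denseRange_toLp_vectorMeasure Φ v).induction ?_
      (isClosed_eq (V.continuous.inner continuous_const) continuous_const)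
    rintro _ ⟨f', rfl⟩
    rw [hV, inner_starHom, hvw]
  refine (denseRange_toLp_vectorMeasure Φ w).induction (P := fun h => inner ℂ (V g) (W h) = 0) ?_
    (isClosed_eq (continuous_const.inner W.continuous) continuous_const) h
  rintro _ ⟨f, rfl⟩
  rw [hW, h1]

/-- Every representation of `C(X, ℂ)` is a Hilbert sum of multiplication representations. -/
theorem exists_isHilbertSum (Φ : C(X, ℂ) →⋆ₐ[ℂ] (E →L[ℂ] E)) :
    ∃ S : Set E, (∀ v ∈ S, v ≠ 0) ∧ (S.Pairwise fun v w => inner ℂ v w = 0) ∧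
      ∃ (μ : S → Measure X) (V : ∀ v, Lp ℂ 2 (μ v) →ₗᵢ[ℂ] E), (∀ v, IsFiniteMeasure (μ v)) ∧
        IsHilbertSum ℂ (fun v => Lp ℂ 2 (μ v)) V ∧
        ∀ v, ∀ f : C(X, ℂ), Intertwines f (Φ f) (V v) := by
  obtain ⟨S, hne, hpw, hmax⟩ := exists_maximal_orthogonal_cyclic Φ
  choose V hV hint using fun v : S => exists_cyclic_isometry Φ (v : E)
  refine ⟨S, hne, fun v hv w hw hvw => ?_, fun v => vectorMeasure Φ v, V, fun v => inferInstance,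
    IsHilbertSum.mk ?_ ?_, hint⟩
  · have h := hpw hv hw hvw 1
    rwa [map_one, one_apply_eq_self] at h
  · intro v w hvw g h
    have hvw' : (v : E) ≠ w := fun h => hvw (Subtype.ext h)
    exact inner_eq_zero_of_cyclic (hV v) (hV w) (hpw v.2 w.2 hvw') g h
  -- Totality is the maximality of `S`: each `Φ f v` lies in the range of the isometry of `v`.
  · rw [top_le_iff, Submodule.topologicalClosure_eq_top_iff, Submodule.eq_bot_iff]
    intro w hw
    refine hmax w fun v hv f => ?_
    rw [Submodule.mem_orthogonal] at hw
    refine hw _ (Submodule.mem_iSup_of_mem ⟨v, hv⟩ ⟨ContinuousMap.toLp 2 _ ℂ f, ?_⟩)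
    exact hV ⟨v, hv⟩ f

end Cyclic

/-! ### Reparametrizing Hilbert sums. -/

section HilbertSum

variable {E : Type*} [NormedAddCommGroup E] [InnerProductSpace ℂ E] [CompleteSpace E]

/-- Whether a family of isometries is a Hilbert sum depends only on their ranges. -/
theorem IsHilbertSum.of_range_eq {ι ι' : Type*} {G : ι → Type*} {G' : ι' → Type*}
    [∀ i, NormedAddCommGroup (G i)] [∀ i, InnerProductSpace ℂ (G i)]
    [∀ i, CompleteSpace (G i)]
    [∀ i, NormedAddCommGroup (G' i)] [∀ i, InnerProductSpace ℂ (G' i)]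
    [∀ i, CompleteSpace (G' i)] {V : ∀ i, G i →ₗᵢ[ℂ] E} {V' : ∀ i, G' i →ₗᵢ[ℂ] E}
    (h : IsHilbertSum ℂ G V) (e : ι' ≃ ι)
    (hr : ∀ i, LinearMap.range (V' i).toLinearMap = LinearMap.range (V (e i)).toLinearMap) :
    IsHilbertSum ℂ G' V' := by
  refine IsHilbertSum.mk ?_ ?_
  · intro i j hij x y
    obtain ⟨x', hx⟩ : V' i x ∈ LinearMap.range (V (e i)).toLinearMap := hr i ▸ ⟨x, rfl⟩
    obtain ⟨y', hy⟩ : V' j y ∈ LinearMap.range (V (e j)).toLinearMap := hr j ▸ ⟨y, rfl⟩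
    rw [← hx, ← hy]
    exact h.OrthogonalFamily (e.injective.ne hij) x' y'
  · have h1 : LinearMap.range h.OrthogonalFamily.linearIsometry.toLinearMap = ⊤ :=
      LinearMap.range_eq_top.2 h.surjective_isometry
    rw [h.OrthogonalFamily.range_linearIsometry] at h1
    simp_rw [hr]
    rw [e.iSup_comp (g := fun i => LinearMap.range (V i).toLinearMap), h1]

end HilbertSum

/-! ### From the spectral interval to the half-line. -/

section SpectralInterval

/-- The interval `[0, 1]` in the complex plane. -/
def spectralInterval : Set ℂ := (fun x : ℝ => (x : ℂ)) '' Set.Icc 0 1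

instance : CompactSpace spectralInterval :=
  isCompact_iff_compactSpace.1 (isCompact_Icc.image Complex.continuous_ofReal)

variable {E : Type*} [NormedAddCommGroup E] [InnerProductSpace ℂ E]

theorem spectrum_subset_spectralInterval [CompleteSpace E] {B : E →L[ℂ] E} (hB : B.IsPositive) (hB1 : ‖B‖ ≤ 1) :
    spectrum ℂ B ⊆ spectralInterval := by
  intro z hz
  have hsa : IsSelfAdjoint B := hB.isSelfAdjoint
  have hre : z = z.re := hsa.mem_spectrum_eq_re hz
  have hnn : 0 ≤ z.re := by
    have h0 : (0 : E →L[ℂ] E) ≤ B := (ContinuousLinearMap.nonneg_iff_isPositive B).2 hB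
    refine spectrum_nonneg_of_nonneg h0 ?_
    rw [hre] at hz
    exact (spectrum.algebraMap_mem_iff ℂ (R := ℝ)).1 hz
  refine ⟨z.re, ⟨hnn, ?_⟩, hre.symm⟩
  have h1 := spectrum.subset_closedBall_norm_mul B hz
  rw [mem_closedBall_zero_iff] at h1
  -- Only an inequality, since `E` may be trivial.
  have h2 : ‖(1 : E →L[ℂ] E)‖ ≤ 1 := ContinuousLinearMap.norm_id_le
  calc z.re ≤ ‖z‖ := Complex.re_le_norm z
    _ ≤ ‖B‖ * ‖(1 : E →L[ℂ] E)‖ := h1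
    _ ≤ 1 := mul_le_one₀ hB1 (norm_nonneg _) h2

/-- The bijection `z = 1 / (1 + x)` from the half-line to the interval, with inverse
`halfLineOfInterval`. -/
def intervalOfHalfLine (x : ℝ≥0) : spectralInterval :=
  ⟨resolventSymbol x, (1 + (x : ℝ))⁻¹, ⟨by positivity, inv_le_one_of_one_le₀ (by simp)⟩, by
    simp [resolventSymbol]⟩

/-- The map `z ↦ 1 / z - 1` from the interval to the half-line. -/
def halfLineOfInterval (z : spectralInterval) : ℝ≥0 := ((z : ℂ).re⁻¹ - 1).toNNReal

theorem measurable_intervalOfHalfLine : Measurable intervalOfHalfLine :=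
  measurable_resolventSymbol.subtype_mk

theorem measurable_halfLineOfInterval : Measurable halfLineOfInterval := by
  unfold halfLineOfInterval
  fun_prop

/-- The point `0` corresponds to `x = ∞`; there `halfLineOfInterval` takes the default value `0` and
the identity fails. -/
theorem intervalOfHalfLine_halfLineOfInterval {z : spectralInterval} (hz : (z : ℂ) ≠ 0) :
    intervalOfHalfLine (halfLineOfInterval z) = z := by
  obtain ⟨_, x, ⟨hx0, hx1⟩, rfl⟩ := z
  have hx : 0 < x := lt_of_le_of_ne hx0 fun h => hz (by simp [← h])
  apply Subtype.ext
  have h1 : 0 ≤ x⁻¹ - 1 := sub_nonneg.2 ((one_le_inv₀ hx).2 hx1)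
  change resolventSymbol (((x : ℂ).re⁻¹ - 1).toNNReal) = (x : ℂ)
  rw [resolventSymbol, Complex.ofReal_re, Real.coe_toNNReal _ h1]
  simp

/-- Multiplication by `z` annihilates the indicator of `{0}`, so `V` maps it into the kernel of `B`;
hence it has norm zero and `{0}` is a null set. -/
theorem ae_ne_zero_of_injective {μ : Measure spectralInterval} [IsFiniteMeasure μ]
    {B : E →L[ℂ] E} (hinj : ∀ x, B x = 0 → x = 0) {V : Lp ℂ 2 μ →ₗᵢ[ℂ] E}
    (hV : Intertwines (fun z : spectralInterval => (z : ℂ)) B V) : ∀ᵐ z : spectralInterval ∂μ, (z : ℂ) ≠ 0 := by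
  have hs : MeasurableSet {z : spectralInterval | (z : ℂ) = 0} :=
    measurableSet_eq_fun measurable_subtype_coe measurable_const
  let g : Lp ℂ 2 μ := indicatorConstLp 2 hs (measure_ne_top μ _) (1 : ℂ)
  have h1 : V 0 = B (V g) := by
    refine hV g 0 ?_
    filter_upwards [indicatorConstLp_coeFn (p := 2) (hs := hs) (hμs := measure_ne_top μ _)
      (c := (1 : ℂ)), Lp.coeFn_zero ℂ 2 μ] with z hz h0
    rw [h0, hz]
    by_cases h : (z : ℂ) = 0 <;> simp [h]
  rw [map_zero] at h1
  have h2 : g = 0 := V.injective ((hinj _ h1.symm).trans V.map_zero.symm)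
  have h3 : μ {z : spectralInterval | (z : ℂ) = 0} = 0 := by
    by_contra hne
    have h4 := norm_indicatorConstLp (p := 2) (hs := hs) (hμs := measure_ne_top μ _)
      (c := (1 : ℂ)) two_ne_zero ENNReal.ofNat_ne_top
    change ‖g‖ = _ at h4
    rw [h2, norm_zero, norm_one, one_mul, eq_comm, Real.rpow_eq_zero_iff_of_nonneg (by simp)] at h4
    exact hne ((measureReal_eq_zero_iff).1 h4.1)
  rw [ae_iff]
  simpa using h3

/-- Transport of a multiplication representation from the interval to the half-line. -/
theorem exists_halfLine_isometry {μ : Measure spectralInterval} [IsFiniteMeasure μ]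
    {B : E →L[ℂ] E} (hinj : ∀ x, B x = 0 → x = 0) {V : Lp ℂ 2 μ →ₗᵢ[ℂ] E}
    (hV : Intertwines (fun z : spectralInterval => (z : ℂ)) B V) :
    ∃ ν : Measure ℝ≥0, IsFiniteMeasure ν ∧ ∃ V' : Lp ℂ 2 ν →ₗᵢ[ℂ] E,
      LinearMap.range V'.toLinearMap = LinearMap.range V.toLinearMap ∧
      Intertwines resolventSymbol B V' := by
  have h0 := ae_ne_zero_of_injective hinj hV
  have hid : ∀ᵐ z ∂μ, intervalOfHalfLine (halfLineOfInterval z) = z := by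
    filter_upwards [h0] with z hz using intervalOfHalfLine_halfLineOfInterval hz
  let ν := μ.map halfLineOfInterval
  have ha : MeasurePreserving halfLineOfInterval μ ν := ⟨measurable_halfLineOfInterval, rfl⟩
  -- The round trip is the identity `μ`-almost everywhere, so the inverse map pushes `ν` back to
  -- `μ`; composition with it shows that `J` is onto.
  have hc : MeasurePreserving intervalOfHalfLine ν μ := by
    refine ⟨measurable_intervalOfHalfLine, ?_⟩
    rw [Measure.map_map measurable_intervalOfHalfLine measurable_halfLineOfInterval,
      Measure.map_congr (f := intervalOfHalfLine ∘ halfLineOfInterval) (g := id) hid, Measure.map_id]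
  let J := Lp.compMeasurePreservingₗᵢ ℂ (E := ℂ) (p := 2) halfLineOfInterval ha
  have hJ : ∀ g, J g =ᵐ[μ] g ∘ halfLineOfInterval := fun g =>
    Lp.coeFn_compMeasurePreserving g ha
  have hsurj : Function.Surjective J := by
    intro h
    let K := Lp.compMeasurePreservingₗᵢ ℂ (E := ℂ) (p := 2) intervalOfHalfLine hc
    refine ⟨K h, Lp.ext ?_⟩
    have h1 : K h =ᵐ[ν] h ∘ intervalOfHalfLine := Lp.coeFn_compMeasurePreserving h hc
    have h2 := ha.quasiMeasurePreserving.ae_eq_comp h1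
    filter_upwards [hJ (K h), h2, hid] with z h3 h4 h5
    rw [h3, h4]
    simp [h5]
  refine ⟨ν, inferInstance, V.comp J, ?_, ?_⟩
  · refine le_antisymm ?_ ?_
    · rintro _ ⟨x, rfl⟩
      exact ⟨J x, rfl⟩
    · rintro _ ⟨x, rfl⟩
      obtain ⟨y, rfl⟩ := hsurj x
      exact ⟨y, rfl⟩
  · intro g h hgh
    refine hV (J g) (J h) ?_
    have h2 := ha.quasiMeasurePreserving.ae_eq_comp hgh
    filter_upwards [hJ g, hJ h, h2, hid] with z h3 h4 h5 h6
    rw [h3, h4, h5]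
    have : resolventSymbol (halfLineOfInterval z) = (z : ℂ) := congrArg Subtype.val h6
    simp [this]

/-- A positive injective contraction is unitarily equivalent to a Hilbert sum of multiplications
by `1 / (1 + x)` on the half-line. -/
theorem exists_isHilbertSum_halfLine [CompleteSpace E] {B : E →L[ℂ] E} (hB : B.IsPositive)
    (hB1 : ‖B‖ ≤ 1) (hinj : ∀ x, B x = 0 → x = 0) :
    ∃ S : Set E, (∀ v ∈ S, v ≠ 0) ∧ (S.Pairwise fun v w => inner ℂ v w = 0) ∧
      ∃ (ν : S → Measure ℝ≥0) (V : ∀ v, Lp ℂ 2 (ν v) →ₗᵢ[ℂ] E), (∀ v, IsFiniteMeasure (ν v)) ∧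
        IsHilbertSum ℂ (fun v => Lp ℂ 2 (ν v)) V ∧
        ∀ v, Intertwines resolventSymbol B (V v) := by
  have hn : IsStarNormal B := hB.isSelfAdjoint.isStarNormal
  let Φ := cfcHomSuperset hn (spectrum_subset_spectralInterval hB hB1)
  obtain ⟨S, hS0, hSp, μ, V, hfin, hsum, hint⟩ := exists_isHilbertSum Φ
  have hΦ : Φ (.restrict spectralInterval <| .id ℂ) = B := cfcHomSuperset_id hn _
  choose ν hν V' hr hV' using fun v => exists_halfLine_isometry (V := V v) hinj
    (hΦ ▸ hint v (.restrict spectralInterval <| .id ℂ))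
  exact ⟨S, hS0, hSp, ν, V', hν, IsHilbertSum.of_range_eq hsum (Equiv.refl _) hr, hV'⟩

end SpectralInterval

/-! ### Square norms as sums and integrals in `[0, ∞]`. -/

section SquareNorms

/-- With values in `[0, ∞]`, sums and integrals can be interchanged before finiteness is known;
membership in `ℓ²` or `L²` is finiteness of the result. -/
theorem memℓp_two_iff {ι : Type*} {G : ι → Type*} [∀ i, NormedAddCommGroup (G i)]
    {f : ∀ i, G i} : Memℓp f 2 ↔ ∑' i, ‖f i‖ₑ ^ 2 ≠ ⊤ := by
  rw [memℓp_gen_iff (by simp)]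
  have h : ∀ i, ‖f i‖ₑ ^ 2 = ((‖f i‖₊ ^ 2 : ℝ≥0) : ENNReal) := fun i => by
    rw [ENNReal.coe_pow]
    rfl
  simp_rw [h]
  rw [ENNReal.tsum_coe_ne_top_iff_summable, ← NNReal.summable_coe]
  simp

theorem enorm_sq_lp {ι : Type*} {G : ι → Type*} [∀ i, NormedAddCommGroup (G i)] (x : lp G 2) :
    ‖x‖ₑ ^ 2 = ∑' i, ‖x i‖ₑ ^ 2 := by
  have h := lp.hasSum_norm (p := 2) (by simp) x
  simp only [ENNReal.toReal_ofNat, Real.rpow_ofNat] at h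
  have h2 : ∀ i, ‖x i‖ₑ ^ 2 = ENNReal.ofReal (‖x i‖ ^ 2) := fun i => by
    rw [ENNReal.ofReal_pow (norm_nonneg _), ofReal_norm]
  have h3 : ‖x‖ₑ ^ 2 = ENNReal.ofReal (‖x‖ ^ 2) := by
    rw [ENNReal.ofReal_pow (norm_nonneg _), ofReal_norm]
  rw [tsum_congr h2, h3, ← h.tsum_eq, ENNReal.ofReal_tsum_of_nonneg (fun i => sq_nonneg _) h.summable]

variable {Y F : Type*} [MeasurableSpace Y] {ν : Measure Y} [NormedAddCommGroup F]

theorem eLpNorm_two_sq (f : Y → F) : eLpNorm f 2 ν ^ 2 = ∫⁻ x, ‖f x‖ₑ ^ 2 ∂ν := by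
  rw [eLpNorm_eq_lintegral_rpow_enorm_toReal two_ne_zero ENNReal.ofNat_ne_top,
    ← ENNReal.rpow_natCast, ← ENNReal.rpow_mul]
  simp

theorem memLp_two_iff {f : Y → F} (hf : AEStronglyMeasurable f ν) :
    MemLp f 2 ν ↔ ∫⁻ x, ‖f x‖ₑ ^ 2 ∂ν ≠ ⊤ := by
  rw [← eLpNorm_two_sq, MemLp, and_iff_right hf, lt_top_iff_ne_top]
  simp

theorem enorm_sq_Lp (g : Lp F 2 ν) : ‖g‖ₑ ^ 2 = ∫⁻ x, ‖g x‖ₑ ^ 2 ∂ν := by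
  rw [← eLpNorm_two_sq, Lp.enorm_def]

theorem enorm_sq_toLp {f : Y → F} (hf : MemLp f 2 ν) :
    ‖hf.toLp f‖ₑ ^ 2 = ∫⁻ x, ‖f x‖ₑ ^ 2 ∂ν := by
  rw [← eLpNorm_two_sq, Lp.enorm_toLp]

variable {X : Y → Type*} [∀ p, NormedAddCommGroup (X p)] [∀ p, InnerProductSpace ℂ (X p)]
  {M : MeasurableField X}

theorem L2Section.enorm_sq (s : L2Section M ν) : ‖s‖ₑ ^ 2 = ∫⁻ p, ‖s p‖ₑ ^ 2 ∂ν := by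
  have h : ‖s‖ₑ ^ 2 = ENNReal.ofReal (‖s‖ ^ 2) := by
    rw [ENNReal.ofReal_pow (norm_nonneg _), ofReal_norm]
  rw [h, L2Section.norm_sq_eq, ofReal_integral_eq_lintegral_ofReal s.integrable_norm_sq
    (Filter.Eventually.of_forall fun p => sq_nonneg _)]
  refine lintegral_congr fun p => ?_
  rw [ENNReal.ofReal_pow (norm_nonneg _), ofReal_norm]

theorem L2Section.lintegral_ne_top (s : L2Section M ν) : ∫⁻ p, ‖s p‖ₑ ^ 2 ∂ν ≠ ⊤ := by
  rw [← s.enorm_sq]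
  simp

/-- A measurable section with finite square integral, as an element of `L2Section`. -/
def L2Section.ofLintegral (x : ∀ p, X p) (hx : x ∈ M.sections)
    (hx' : ∫⁻ p, ‖x p‖ₑ ^ 2 ∂ν ≠ ⊤) : L2Section M ν :=
  L2Section.of x hx ((memLp_two_iff (M.measurable_norm _ hx).aestronglyMeasurable).2 (by
    simpa using hx'))

end SquareNorms

/-! ### Spectral representations from coordinate maps. -/

section OfHilbertSum

universe v

variable {E : Type*} [NormedAddCommGroup E] [InnerProductSpace ℂ E] [CompleteSpace E]
  {D : E →ₗ.[ℂ] E} {Ω : Type*} [MeasurableSpace Ω] {μ : Measure Ω} {a : Ω → ℝ≥0}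
  {X : Ω → Type v} [∀ p, NormedAddCommGroup (X p)] [∀ p, InnerProductSpace ℂ (X p)]
  {M : MeasurableField X} {ι : Type*} {G : ι → Type*} [∀ i, NormedAddCommGroup (G i)]
  [∀ i, InnerProductSpace ℂ (G i)]

/-- Coordinate maps on the square integrable sections identify the direct integral with a
Hilbert sum. -/
theorem exists_directIntegral_equiv (c : ∀ i, L2Section M μ →ₗ[ℂ] G i)
    (hc : ∀ s, ∑' i, ‖c i s‖ₑ ^ 2 = ‖s‖ₑ ^ 2)
    (hsurj : ∀ g : ∀ i, G i, ∑' i, ‖g i‖ₑ ^ 2 ≠ ⊤ → ∃ s, ∀ i, c i s = g i) :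
    ∃ T : DirectIntegral M μ ≃ₗᵢ[ℂ] lp G 2, ∀ s i, T (SeparationQuotient.mk s) i = c i s := by
  have hmem : ∀ s, Memℓp (fun i => c i s) 2 := fun s => memℓp_two_iff.2 (by rw [hc]; simp)
  let T₀ : L2Section M μ →ₗᵢ[ℂ] lp G 2 :=
    { toFun := fun s => ⟨fun i => c i s, hmem s⟩
      map_add' := fun s t => by
        ext i
        exact map_add (c i) s t
      map_smul' := fun r s => by
        ext i
        exact map_smul (c i) r s
      norm_map' := fun s => by
        have h : ‖(⟨fun i => c i s, hmem s⟩ : lp G 2)‖ₑ ^ 2 = ‖s‖ₑ ^ 2 := by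
          rw [enorm_sq_lp, ← hc]
        have h' : ‖(⟨fun i => c i s, hmem s⟩ : lp G 2)‖ₑ = ‖s‖ₑ :=
          (ENNReal.pow_right_strictMono two_ne_zero).injective h
        exact congrArg ENNReal.toReal h' |>.trans (toReal_enorm s) |> (toReal_enorm _).symm.trans }
  have hins : ∀ s t, Inseparable s t → T₀ s = T₀ t := fun s t h =>
    (h.map T₀.continuous).eq
  let T₁ : DirectIntegral M μ →ₗᵢ[ℂ] lp G 2 :=
    { toLinearMap :=
        (SeparationQuotient.liftCLM T₀.toContinuousLinearMap hins).toLinearMap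
      norm_map' := fun x => by
        obtain ⟨s, rfl⟩ := SeparationQuotient.surjective_mk x
        exact (T₀.norm_map s).trans (SeparationQuotient.norm_mk s).symm }
  refine ⟨LinearIsometryEquiv.ofSurjective T₁ fun g => ?_, fun s i => rfl⟩
  obtain ⟨s, hs⟩ := hsurj g (memℓp_two_iff.1 g.2)
  exact ⟨SeparationQuotient.mk s, lp.ext (funext hs)⟩

/-- A spectral representation from a Hilbert sum of multiplication operators and coordinate maps
on the square integrable sections of a measurable field. -/
theorem nonempty_spectralRepresentation [∀ p, CompleteSpace (X p)] {B : E →L[ℂ] E}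
    (hB : IsResolvent D B) (ha : Measurable a) {ν : ι → Measure ℝ≥0}
    {V : ∀ i, Lp ℂ 2 (ν i) →ₗᵢ[ℂ] E} (hV : IsHilbertSum ℂ (fun i => Lp ℂ 2 (ν i)) V)
    (hint : ∀ i, Intertwines resolventSymbol B (V i))
    (c : ∀ i, L2Section M μ →ₗ[ℂ] Lp ℂ 2 (ν i))
    (hc : ∀ s, ∑' i, ‖c i s‖ₑ ^ 2 = ‖s‖ₑ ^ 2)
    (hsurj : ∀ g : ∀ i, Lp ℂ 2 (ν i), ∑' i, ‖g i‖ₑ ^ 2 ≠ ⊤ → ∃ s, ∀ i, c i s = g i)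
    (hmul : ∀ s t : L2Section M μ, (∀ p, t p = resolventSymbol (a p) • s p) →
      ∀ i, c i t =ᵐ[ν i] fun x => resolventSymbol x * c i s x) :
    Nonempty (SpectralRepresentation.{_, _, v} D μ a) := by
  obtain ⟨T, hT⟩ := exists_directIntegral_equiv c hc hsurj
  refine ⟨SpectralRepresentation.ofResolvent hB M ha (hV.linearIsometryEquiv.trans T.symm)
    fun s t hst => ?_⟩
  have h1 : ∀ s : L2Section M μ,
      HasSum (fun i => V i (c i s))
        ((hV.linearIsometryEquiv.trans T.symm).symm (SeparationQuotient.mk s)) := by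
    intro s
    have h := hV.hasSum_linearIsometryEquiv_symm (T (SeparationQuotient.mk s))
    simp only [hT] at h
    exact h
  -- `B` passes through the convergent sum of the pieces and acts on each one as multiplication by
  -- `1 / (1 + x)`.
  have h2 := B.hasSum (h1 s)
  have h3 := h1 t
  simp only [hint _ _ _ (hmul s t hst _)] at h3
  exact h2.unique h3

end OfHilbertSum

/-! ### The general case: scalar functions on a disjoint union. -/

section ScalarField

/-- The constant field with fibre `ℂ`, whose measurable sections are the measurable functions. -/
def scalarField (Ω : Type*) [MeasurableSpace Ω] : MeasurableField fun _ : Ω => ℂ where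
  sections :=
    { carrier := {x | Measurable x}
      zero_mem' := measurable_zero
      add_mem' := fun hx hy => Measurable.add hx hy
      smul_mem' := fun c _ hx => Measurable.const_smul hx c }
  measurable_norm x hx := Measurable.norm hx
  mem_of_measurable_inner y hy := by
    have h := hy (fun _ => 1) measurable_const
    simpa using h
  exists_total := by
    refine ⟨fun _ _ => 1, fun _ => measurable_const, fun p => ?_⟩
    have : Submodule.span ℂ (Set.range fun _ : ℕ => (1 : ℂ)) = ⊤ := by
      rw [Set.range_const]
      exact Ideal.span_singleton_one
    rw [this]
    exact dense_univ

variable {ι Y : Type*} [MeasurableSpace Y]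

theorem measurable_sigmaMk (i : ι) : Measurable fun y => (⟨i, y⟩ : Σ _ : ι, Y) :=
  Measurable.of_le_map (iInf_le _ i)

theorem measurable_of_sigma {Z : Type*} [MeasurableSpace Z] {f : (Σ _ : ι, Y) → Z}
    (hf : ∀ i, Measurable fun y => f ⟨i, y⟩) : Measurable f := by
  intro s hs
  exact MeasurableSpace.measurableSet_iInf.2 fun i => hf i hs

/-- The disjoint union of a family of measures. -/
def sigmaMeasure (ν : ι → Measure Y) : Measure (Σ _ : ι, Y) :=
  Measure.sum fun i => (ν i).map fun y => ⟨i, y⟩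

theorem lintegral_sigmaMeasure (ν : ι → Measure Y) {f : (Σ _ : ι, Y) → ENNReal}
    (hf : Measurable f) : ∫⁻ p, f p ∂(sigmaMeasure ν) = ∑' i, ∫⁻ y, f ⟨i, y⟩ ∂(ν i) := by
  rw [sigmaMeasure, lintegral_sum_measure]
  exact tsum_congr fun i => lintegral_map hf (measurable_sigmaMk i)

theorem scalarSection_measurable {Ω : Type*} [MeasurableSpace Ω] {μ : Measure Ω}
    (s : L2Section (scalarField Ω) μ) : Measurable (fun p => s p) := s.2.1

theorem memLp_fiber {ν : ι → Measure Y} (s : L2Section (scalarField (Σ _ : ι, Y)) (sigmaMeasure ν))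
    (i : ι) : MemLp (fun y => s ⟨i, y⟩) 2 (ν i) := by
  have hm := scalarSection_measurable s
  refine (memLp_two_iff (hm.comp (measurable_sigmaMk i)).aestronglyMeasurable).2 ?_
  have h := s.lintegral_ne_top
  rw [lintegral_sigmaMeasure ν (hm.enorm.pow_const 2)] at h
  exact ne_top_of_le_ne_top h (ENNReal.le_tsum i)

/-- The restriction of a square integrable function on a disjoint union to one of the pieces. -/
def fiberCoord (ν : ι → Measure Y) (i : ι) :
    L2Section (scalarField (Σ _ : ι, Y)) (sigmaMeasure ν) →ₗ[ℂ] Lp ℂ 2 (ν i) where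
  toFun s := (memLp_fiber s i).toLp _
  map_add' s t := MemLp.toLp_add (memLp_fiber s i) (memLp_fiber t i)
  map_smul' c s := MemLp.toLp_const_smul c (memLp_fiber s i)

theorem tsum_enorm_fiberCoord (ν : ι → Measure Y)
    (s : L2Section (scalarField (Σ _ : ι, Y)) (sigmaMeasure ν)) :
    ∑' i, ‖fiberCoord ν i s‖ₑ ^ 2 = ‖s‖ₑ ^ 2 := by
  rw [s.enorm_sq, lintegral_sigmaMeasure ν ((scalarSection_measurable s).enorm.pow_const 2)]
  exact tsum_congr fun i => enorm_sq_toLp (memLp_fiber s i)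

/-- Measurability on the disjoint union is tested on each piece, so measurable representatives glue
even over an uncountable index set. -/
theorem exists_fiberCoord_eq (ν : ι → Measure Y) (g : ∀ i, Lp ℂ 2 (ν i))
    (hg : ∑' i, ‖g i‖ₑ ^ 2 ≠ ⊤) :
    ∃ s : L2Section (scalarField (Σ _ : ι, Y)) (sigmaMeasure ν), ∀ i, fiberCoord ν i s = g i := by
  have hm : Measurable fun p : Σ _ : ι, Y => g p.1 p.2 :=
    measurable_of_sigma fun i => (Lp.stronglyMeasurable (g i)).measurable
  refine ⟨L2Section.ofLintegral (fun p => g p.1 p.2) hm ?_, fun i => Lp.toLp_coeFn (g i) (Lp.memLp (g i))⟩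
  rw [lintegral_sigmaMeasure ν (hm.enorm.pow_const 2)]
  simpa only [enorm_sq_Lp] using hg

/-- A nonnegative self-adjoint operator has a spectral representation with one-dimensional
fibres. -/
theorem exists_scalar_spectralRepresentation {E : Type*} [NormedAddCommGroup E]
    [InnerProductSpace ℂ E] [CompleteSpace E] {D : E →ₗ.[ℂ] E} {B : E →L[ℂ] E}
    (hB : IsResolvent D B) {ν : ι → Measure ℝ≥0}
    {V : ∀ i, Lp ℂ 2 (ν i) →ₗᵢ[ℂ] E} (hV : IsHilbertSum ℂ (fun i => Lp ℂ 2 (ν i)) V)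
    (hint : ∀ i, Intertwines resolventSymbol B (V i)) :
    Nonempty (SpectralRepresentation.{_, _, 0} D (sigmaMeasure ν) Sigma.snd) := by
  refine nonempty_spectralRepresentation hB (measurable_of_sigma fun i => measurable_id) hV hint
    (fiberCoord ν) (tsum_enorm_fiberCoord ν) (exists_fiberCoord_eq ν) fun s t hst i => ?_
  filter_upwards [(memLp_fiber s i).coeFn_toLp, (memLp_fiber t i).coeFn_toLp] with x hs ht
  change (memLp_fiber t i).toLp _ x = resolventSymbol x * (memLp_fiber s i).toLp _ x
  rw [hs, ht, hst]
  rfl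

end ScalarField

/-- The balls of radius `‖v‖ / 2` around the vectors are disjoint, because `‖v - w‖² = ‖v‖² + ‖w‖²`
is at least `(‖v‖ / 2 + ‖w‖ / 2)²`. -/
theorem countable_of_pairwise_orthogonal {E : Type*} [NormedAddCommGroup E]
    [InnerProductSpace ℂ E] [TopologicalSpace.SeparableSpace E] {S : Set E}
    (h0 : ∀ v ∈ S, v ≠ 0) (h : S.Pairwise fun v w => inner ℂ v w = 0) : S.Countable := by
  refine Set.PairwiseDisjoint.countable_of_isOpen (s := fun v : E => Metric.ball v (‖v‖ / 2))
    ?_ (fun v _ => Metric.isOpen_ball) fun v hv => ⟨v, Metric.mem_ball_self ?_⟩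
  · intro v hv w hw hvw
    refine Set.disjoint_left.2 fun x hxv hxw => ?_
    rw [Metric.mem_ball] at hxv hxw
    have h1 : dist v w < ‖v‖ / 2 + ‖w‖ / 2 :=
      (dist_triangle_left v w x).trans_lt (add_lt_add hxv hxw)
    have h2 : ‖v - w‖ ^ 2 = ‖v‖ ^ 2 + ‖w‖ ^ 2 := by
      rw [norm_sub_sq (𝕜 := ℂ), h hv hw hvw]
      simp
    rw [dist_eq_norm] at h1
    have h3 := pow_lt_pow_left₀ h1 (norm_nonneg _) two_ne_zero
    nlinarith [sq_nonneg (‖v‖ - ‖w‖), sq_nonneg ‖v‖, sq_nonneg ‖w‖]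
  · have := norm_pos_iff.2 (h0 v hv)
    positivity

/-! ### Replacing a measure by a restriction of a dominating one. -/

section Density

variable {E : Type*} [NormedAddCommGroup E] [InnerProductSpace ℂ E]
  {Y : Type*} [MeasurableSpace Y] {m : Measure Y}

theorem ae_withDensity_eq_ae_restrict {ρ : Y → ℝ≥0} (hρ : Measurable ρ) :
    ae (m.withDensity fun x => ρ x) = ae (m.restrict {x | ρ x ≠ 0}) := by
  have hS : MeasurableSet {x | ρ x ≠ 0} := hρ (measurableSet_singleton 0).compl
  ext s
  change (∀ᵐ x ∂(m.withDensity fun x => ρ x), x ∈ s) ↔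
    (∀ᵐ x ∂(m.restrict {x | ρ x ≠ 0}), x ∈ s)
  rw [ae_withDensity_iff hρ.coe_nnreal_ennreal, ae_restrict_iff' hS]
  simp

theorem lintegral_withDensity_eq_setLIntegral {ρ : Y → ℝ≥0} (hρ : Measurable ρ)
    {f : Y → ENNReal} (hf : Measurable f) :
    ∫⁻ x, f x ∂(m.withDensity fun x => ρ x) = ∫⁻ x in {x | ρ x ≠ 0}, ρ x * f x ∂m := by
  have hS : MeasurableSet {x | ρ x ≠ 0} := hρ (measurableSet_singleton 0).compl
  rw [lintegral_withDensity_eq_lintegral_mul _ hρ.coe_nnreal_ennreal hf, ← lintegral_indicator hS]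
  refine lintegral_congr fun x => ?_
  by_cases hx : ρ x = 0
  · simp [hx]
  · rw [Set.indicator_of_mem (show x ∈ {x | ρ x ≠ 0} from hx)]
    rfl

/-- A measure with a density is unitarily equivalent to the restriction to the support of the
density. -/
theorem exists_withDensity_isometry {ρ : Y → ℝ≥0} (hρ : Measurable ρ) :
    ∃ J : Lp ℂ 2 (m.restrict {x | ρ x ≠ 0}) →ₗᵢ[ℂ] Lp ℂ 2 (m.withDensity fun x => ρ x),
      Function.Surjective J ∧ ∀ g, J g =ᵐ[m.restrict {x | ρ x ≠ 0}]
        fun x => ((NNReal.sqrt (ρ x) : ℝ) : ℂ)⁻¹ * g x := by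
  set S : Set Y := {x | ρ x ≠ 0}
  set ν := m.withDensity fun x => (ρ x : ENNReal)
  have hS : MeasurableSet S := hρ (measurableSet_singleton 0).compl
  have hae : ae ν = ae (m.restrict S) := ae_withDensity_eq_ae_restrict hρ
  let r : Y → ℂ := fun x => ((NNReal.sqrt (ρ x) : ℝ) : ℂ)
  have hr : Measurable r := by
    have : Measurable fun x => NNReal.sqrt (ρ x) := NNReal.continuous_sqrt.measurable.comp hρ
    exact Complex.measurable_ofReal.comp this.coe_nnreal_real
  have hr2 : ∀ x, ‖r x‖ₑ ^ 2 = ρ x := by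
    intro x
    have h1 : ‖r x‖ₑ = NNReal.sqrt (ρ x) := by
      rw [enorm_eq_nnnorm]
      congr 1
      ext
      simp [r]
    rw [h1, ← ENNReal.coe_pow, NNReal.sq_sqrt]
  have hr0 : ∀ x ∈ S, r x ≠ 0 := by
    intro x hx h0
    have := hr2 x
    rw [h0, enorm_zero, zero_pow two_ne_zero] at this
    exact hx (by exact_mod_cast this.symm)
  -- Since `|r|² = ρ`, this identity serves both for division by `r`, which is `J`, and for
  -- multiplication by `r`, its inverse.
  have hnorm : ∀ f g : Y → ℂ, Measurable f → (∀ x ∈ S, r x * f x = g x) →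
      ∫⁻ x, ‖f x‖ₑ ^ 2 ∂ν = ∫⁻ x in S, ‖g x‖ₑ ^ 2 ∂m := by
    intro f g hf hfg
    rw [lintegral_withDensity_eq_setLIntegral hρ (hf.enorm.pow_const 2)]
    refine setLIntegral_congr_fun hS fun x hx => ?_
    rw [← hfg x hx, enorm_mul, mul_pow, hr2]
  have hgm : ∀ g : Lp ℂ 2 (m.restrict S), Measurable g := fun g =>
    (Lp.stronglyMeasurable g).measurable
  have hJm : ∀ g : Lp ℂ 2 (m.restrict S), Measurable fun x => (r x)⁻¹ * g x := fun g =>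
    hr.inv.mul (hgm g)
  have hJn : ∀ g : Lp ℂ 2 (m.restrict S),
      ∫⁻ x, ‖(r x)⁻¹ * g x‖ₑ ^ 2 ∂ν = ∫⁻ x in S, ‖g x‖ₑ ^ 2 ∂m := fun g =>
    hnorm _ _ (hJm g) fun x hx => mul_inv_cancel_left₀ (hr0 x hx) _
  have hJL : ∀ g : Lp ℂ 2 (m.restrict S), MemLp (fun x => (r x)⁻¹ * g x) 2 ν := fun g => by
    rw [memLp_two_iff (hJm g).aestronglyMeasurable, hJn, ← enorm_sq_Lp]
    simp
  let J : Lp ℂ 2 (m.restrict S) →ₗᵢ[ℂ] Lp ℂ 2 ν :=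
    { toFun := fun g => (hJL g).toLp _
      map_add' := fun g h => by
        rw [← MemLp.toLp_add, MemLp.toLp_eq_toLp_iff]
        rw [hae]
        filter_upwards [Lp.coeFn_add g h] with x hx
        simp only [hx, Pi.add_apply, mul_add]
      map_smul' := fun c g => by
        rw [RingHom.id_apply, ← MemLp.toLp_const_smul, MemLp.toLp_eq_toLp_iff]
        rw [hae]
        filter_upwards [Lp.coeFn_smul c g] with x hx
        simp only [hx, Pi.smul_apply, smul_eq_mul]
        ring
      norm_map' := fun g => by
        have h : ‖(hJL g).toLp _‖ₑ ^ 2 = ‖g‖ₑ ^ 2 := by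
          rw [enorm_sq_toLp, hJn, ← enorm_sq_Lp]
        have h' := congrArg ENNReal.toReal ((ENNReal.pow_right_strictMono two_ne_zero).injective h)
        rwa [toReal_enorm, toReal_enorm] at h' }
  have hJ : ∀ g, J g =ᵐ[m.restrict S] fun x => (r x)⁻¹ * g x := by
    intro g
    have h : J g =ᶠ[ae ν] fun x => (r x)⁻¹ * g x := (hJL g).coeFn_toLp
    rwa [hae] at h
  refine ⟨J, fun h => ?_, hJ⟩
  have hhm : Measurable h := (Lp.stronglyMeasurable h).measurable
  have hL : MemLp (fun x => r x * h x) 2 (m.restrict S) := by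
    refine (memLp_two_iff (hr.mul hhm).aestronglyMeasurable).2 ?_
    rw [← hnorm h (r * h) hhm fun x _ => rfl, ← enorm_sq_Lp]
    simp
  refine ⟨hL.toLp _, Lp.ext ?_⟩
  rw [hae]
  filter_upwards [hJ (hL.toLp _), hL.coeFn_toLp, ae_restrict_mem hS] with x h1 h2 h3
  rw [h1, h2, inv_mul_cancel_left₀ (hr0 x h3)]

/-- Transport of a multiplication representation to the restriction of a dominating measure. -/
theorem exists_restrict_isometry {ν : Measure Y} [SigmaFinite ν] [SigmaFinite m] (hν : ν ≪ m)
    {φ : Y → ℂ} {B : E →L[ℂ] E} {V : Lp ℂ 2 ν →ₗᵢ[ℂ] E} (hV : Intertwines φ B V) :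
    ∃ S : Set Y, MeasurableSet S ∧ ∃ V' : Lp ℂ 2 (m.restrict S) →ₗᵢ[ℂ] E,
      LinearMap.range V'.toLinearMap = LinearMap.range V.toLinearMap ∧ Intertwines φ B V' := by
  -- The Radon-Nikodym derivative is finite almost everywhere, so it may be taken with values in
  -- `ℝ≥0`.
  obtain ⟨ρ, hρ, rfl⟩ : ∃ ρ : Y → ℝ≥0, Measurable ρ ∧ ν = m.withDensity fun x => ρ x := by
    refine ⟨_, (Measure.measurable_rnDeriv ν m).ennreal_toNNReal, ?_⟩
    nth_rewrite 1 [← Measure.withDensity_rnDeriv_eq ν m hν]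
    refine withDensity_congr_ae ?_
    filter_upwards [Measure.rnDeriv_ne_top ν m] with x hx
    exact (ENNReal.coe_toNNReal hx).symm
  obtain ⟨J, hsurj, hJ⟩ := exists_withDensity_isometry (m := m) hρ
  refine ⟨{x | ρ x ≠ 0}, hρ (measurableSet_singleton 0).compl, V.comp J, ?_, ?_⟩
  · refine le_antisymm ?_ ?_
    · rintro _ ⟨x, rfl⟩
      exact ⟨J x, rfl⟩
    · rintro _ ⟨x, rfl⟩
      obtain ⟨y, rfl⟩ := hsurj x
      exact ⟨y, rfl⟩
  · intro g h hgh
    refine hV (J g) (J h) ?_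
    rw [ae_withDensity_eq_ae_restrict hρ]
    filter_upwards [hJ g, hJ h, hgh] with x h1 h2 h3
    rw [h1, h2, h3]
    ring

end Density

/-! ### The separable case: sequence spaces over the half-line. -/

section SequenceField

variable {ι Y : Type*}

/-- The square summable sequences which vanish at the indices `i` with `p ∉ S i`. -/
def sequenceFiber (S : ι → Set Y) (p : Y) : Submodule ℂ (lp (fun _ : ι => ℂ) 2) where
  carrier := {x | ∀ i, p ∉ S i → x i = 0}
  zero_mem' := fun i _ => rfl
  add_mem' := fun {x y} hx hy i hi => by
    rw [lp.coeFn_add, Pi.add_apply, hx i hi, hy i hi, add_zero]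
  smul_mem' := fun c x hx i hi => by
    rw [lp.coeFn_smul, Pi.smul_apply, hx i hi, smul_zero]

instance (S : ι → Set Y) (p : Y) : CompleteSpace (sequenceFiber S p) := by
  have h : IsClosed (sequenceFiber S p : Set (lp (fun _ : ι => ℂ) 2)) := by
    have : (sequenceFiber S p : Set (lp (fun _ : ι => ℂ) 2)) =
        ⋂ (i) (_ : p ∉ S i), {x | lp.evalCLM ℂ (fun _ : ι => ℂ) 2 i x = 0} := by
      ext x
      simp only [Set.mem_iInter]
      rfl
    rw [this]
    exact isClosed_iInter fun i => isClosed_iInter fun _ =>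
      isClosed_eq (ContinuousLinearMap.continuous _) continuous_const
  exact h.completeSpace_coe

theorem enorm_sq_sequenceFiber {S : ι → Set Y} {p : Y} (x : sequenceFiber S p) :
    ‖x‖ₑ ^ 2 = ∑' i, ‖x.1 i‖ₑ ^ 2 := enorm_sq_lp x.1

open scoped Classical in
/-- The `i`-th unit vector, cut off outside `S i`. -/
def unitSection (S : ι → Set Y) (i : ι) (p : Y) : sequenceFiber S p :=
  if h : p ∈ S i then ⟨lp.single 2 i 1, fun j hj => by
    rw [lp.single_apply_ne]
    rintro rfl
    exact hj h⟩ else 0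

/-- Coordinates are pairings with measurable sections. Both the maximality axiom and the totality of
the field below rest on this. -/
theorem inner_unitSection (S : ι → Set Y) (i : ι) (p : Y) (x : sequenceFiber S p) :
    inner ℂ (unitSection S i p) x = x.1 i := by
  classical
  by_cases h : p ∈ S i
  · rw [unitSection, dif_pos h, Submodule.coe_inner]
    have := lp.inner_single_left (𝕜 := ℂ) i (1 : ℂ) x.1
    simp only [RCLike.inner_apply, map_one, mul_one] at this
    convert this
  · rw [unitSection, dif_neg h, inner_zero_left, x.2 i h]

variable [MeasurableSpace Y]

theorem measurable_unitSection {S : ι → Set Y} (hS : ∀ i, MeasurableSet (S i)) (i j : ι) :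
    Measurable fun p => (unitSection S i p).1 j := by
  classical
  have h : (fun p => (unitSection S i p).1 j) =
      (S i).indicator fun _ => (lp.single 2 i (1 : ℂ) : lp (fun _ : ι => ℂ) 2) j := by
    ext p
    by_cases h : p ∈ S i
    · rw [unitSection, dif_pos h, Set.indicator_of_mem h]
    · rw [unitSection, dif_neg h, Set.indicator_of_notMem h]
      rfl
  rw [h]
  exact measurable_const.indicator (hS i)

/-- The measurable field of the spaces `sequenceFiber S p`, whose measurable sections are those
with measurable coordinates. -/
def sequenceField [Countable ι] (S : ι → Set Y) (hS : ∀ i, MeasurableSet (S i)) :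
    MeasurableField fun p => sequenceFiber S p where
  sections :=
    { carrier := {x | ∀ i, Measurable fun p => (x p).1 i}
      zero_mem' := fun i => measurable_const
      add_mem' := fun hx hy i => (hx i).add (hy i)
      smul_mem' := fun c _ hx i => (hx i).const_smul c }
  measurable_norm x hx := by
    have h : ∀ p, ‖x p‖ = √(∑' i, ‖(x p).1 i‖ₑ ^ 2).toReal := by
      intro p
      rw [← enorm_sq_sequenceFiber, ENNReal.toReal_pow, toReal_enorm, Real.sqrt_sq (norm_nonneg _)]
    simp_rw [h]
    exact (Measurable.tsum fun i => (hx i).enorm.pow_const 2).ennreal_toReal.sqrt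
  mem_of_measurable_inner y hy i := by
    have h := hy (unitSection S i) (measurable_unitSection hS i)
    simpa only [inner_unitSection] using h
  exists_total := by
    have := Encodable.ofCountable ι
    -- Numbers that encode no index give the zero section.
    refine ⟨fun n => ((Encodable.decode n : Option ι).elim 0 (unitSection S)), fun n => ?_,
      fun p => ?_⟩
    · rcases h : Encodable.decode (α := ι) n with _ | i
      · simp only [h]
        exact fun i => measurable_const
      · simp only [h]
        exact measurable_unitSection hS i
    · rw [Submodule.dense_iff_topologicalClosure_eq_top, Submodule.topologicalClosure_eq_top_iff,
        Submodule.eq_bot_iff]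
      intro y hy
      have h : ∀ i, y.1 i = 0 := by
        intro i
        rw [← inner_unitSection S i p y]
        refine (Submodule.mem_orthogonal _ _).1 hy _ (Submodule.subset_span ⟨Encodable.encode i, ?_⟩)
        simp
      exact Subtype.ext (lp.ext (funext h))

variable [Countable ι] {S : ι → Set Y} {hS : ∀ i, MeasurableSet (S i)} {m : Measure Y}

theorem lintegral_sequenceSection {x : ∀ p, sequenceFiber S p}
    (hx : x ∈ (sequenceField S hS).sections) :
    ∫⁻ p, ‖x p‖ₑ ^ 2 ∂m = ∑' i, ∫⁻ p in S i, ‖(x p).1 i‖ₑ ^ 2 ∂m := by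
  have hm : ∀ i, Measurable fun p => (x p).1 i := hx
  simp_rw [enorm_sq_sequenceFiber]
  rw [lintegral_tsum fun i => ((hm i).enorm.pow_const 2).aemeasurable]
  refine tsum_congr fun i => ?_
  rw [← lintegral_indicator (hS i)]
  refine lintegral_congr fun p => ?_
  by_cases h : p ∈ S i
  · rw [Set.indicator_of_mem h]
  · rw [Set.indicator_of_notMem h, (x p).2 i h]
    simp

theorem memLp_sequenceCoord (s : L2Section (sequenceField S hS) m) (i : ι) :
    MemLp (fun p => (s p).1 i) 2 (m.restrict (S i)) := by
  have hm : Measurable fun p => (s p).1 i := s.2.1 i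
  refine (memLp_two_iff hm.aestronglyMeasurable).2 ?_
  have h := s.lintegral_ne_top
  rw [lintegral_sequenceSection s.2.1] at h
  exact ne_top_of_le_ne_top h (ENNReal.le_tsum i)

/-- The `i`-th coordinate of a square integrable section. -/
def sequenceCoord (S : ι → Set Y) (hS : ∀ i, MeasurableSet (S i)) (m : Measure Y) (i : ι) :
    L2Section (sequenceField S hS) m →ₗ[ℂ] Lp ℂ 2 (m.restrict (S i)) where
  toFun s := (memLp_sequenceCoord s i).toLp _
  map_add' s t := MemLp.toLp_add (memLp_sequenceCoord s i) (memLp_sequenceCoord t i)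
  map_smul' c s := MemLp.toLp_const_smul c (memLp_sequenceCoord s i)

theorem tsum_enorm_sequenceCoord (s : L2Section (sequenceField S hS) m) :
    ∑' i, ‖sequenceCoord S hS m i s‖ₑ ^ 2 = ‖s‖ₑ ^ 2 := by
  rw [s.enorm_sq, lintegral_sequenceSection s.2.1]
  exact tsum_congr fun i => enorm_sq_toLp (memLp_sequenceCoord s i)

/-- The coordinates, extended by zero, are square summable only at almost every `p`, by Tonelli.
Elsewhere they form no element of the fibre, and the section is set to zero off the measurable set
`A`. -/
theorem exists_sequenceCoord_eq (g : ∀ i, Lp ℂ 2 (m.restrict (S i)))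
    (hg : ∑' i, ‖g i‖ₑ ^ 2 ≠ ⊤) :
    ∃ s : L2Section (sequenceField S hS) m, ∀ i, sequenceCoord S hS m i s = g i := by
  classical
  let u : ι → Y → ℂ := fun i => (S i).indicator (g i)
  have hu : ∀ i, Measurable (u i) := fun i =>
    (Lp.stronglyMeasurable (g i)).measurable.indicator (hS i)
  let A : Set Y := {p | ∑' i, ‖u i p‖ₑ ^ 2 < ⊤}
  have hsum : Measurable fun p => ∑' i, ‖u i p‖ₑ ^ 2 :=
    Measurable.tsum fun i => (hu i).enorm.pow_const 2
  have hA : MeasurableSet A := measurableSet_lt hsum measurable_const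
  have hint : ∫⁻ p, ∑' i, ‖u i p‖ₑ ^ 2 ∂m ≠ ⊤ := by
    rw [lintegral_tsum fun i => ((hu i).enorm.pow_const 2).aemeasurable]
    convert hg using 1
    refine tsum_congr fun i => ?_
    rw [enorm_sq_Lp, ← lintegral_indicator (hS i)]
    refine lintegral_congr fun p => ?_
    by_cases h : p ∈ S i <;> simp [u, h]
  have hAae : ∀ᵐ p ∂m, p ∈ A := ae_lt_top hsum hint
  let x : ∀ p, sequenceFiber S p := fun p =>
    if h : p ∈ A then ⟨⟨fun i => u i p, memℓp_two_iff.2 h.ne⟩, fun i hi =>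
      Set.indicator_of_notMem hi _⟩ else 0
  have hx : ∀ i p, (x p).1 i = A.indicator (u i) p := by
    intro i p
    by_cases h : p ∈ A
    · simp only [x, dif_pos h, Set.indicator_of_mem h]
    · simp only [x, dif_neg h, Set.indicator_of_notMem h]
      rfl
  have hxm : x ∈ (sequenceField S hS).sections := fun i => by
    simp only [hx]
    exact (hu i).indicator hA
  refine ⟨L2Section.ofLintegral x hxm ?_, fun i => ?_⟩
  · refine ne_top_of_le_ne_top hint (lintegral_mono fun p => ?_)
    rw [enorm_sq_sequenceFiber]
    refine ENNReal.tsum_le_tsum fun i => ?_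
    rw [hx]
    by_cases h : p ∈ A <;> simp [h]
  · refine Lp.ext ((memLp_sequenceCoord _ i).coeFn_toLp.trans ?_)
    filter_upwards [ae_restrict_of_ae hAae, ae_restrict_mem (hS i)] with p h1 h2
    change (x p).1 i = _
    rw [hx, Set.indicator_of_mem h1]
    exact Set.indicator_of_mem h2 _

/-- A countable Hilbert sum of multiplications on the half-line gives a direct integral over the
half-line. -/
theorem exists_halfLine_spectralRepresentation {ι : Type} [Countable ι] {E : Type*}
    [NormedAddCommGroup E] [InnerProductSpace ℂ E] [CompleteSpace E] {D : E →ₗ.[ℂ] E}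
    {B : E →L[ℂ] E} (hB : IsResolvent D B) {ν : ι → Measure ℝ≥0} [∀ i, IsFiniteMeasure (ν i)]
    {V : ∀ i, Lp ℂ 2 (ν i) →ₗᵢ[ℂ] E} (hV : IsHilbertSum ℂ (fun i => Lp ℂ 2 (ν i)) V)
    (hint : ∀ i, Intertwines resolventSymbol B (V i)) :
    ∃ m : Measure ℝ≥0, SigmaFinite m ∧
      Nonempty (SpectralRepresentation.{_, 0, 0} D m id) := by
  -- A finite measure that dominates every `ν i`; countability of `ι` makes the sum s-finite.
  let m := (Measure.sum ν).toFinite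
  have hac : ∀ i, ν i ≪ m := fun i =>
    (Measure.absolutelyContinuous_sum_right i Measure.AbsolutelyContinuous.rfl).trans
      (absolutelyContinuous_toFinite _)
  choose S hS V' hr hint' using fun i => exists_restrict_isometry (hac i) (hint i)
  refine ⟨m, inferInstance, nonempty_spectralRepresentation hB measurable_id
    (IsHilbertSum.of_range_eq hV (Equiv.refl ι) hr) hint' (sequenceCoord S hS m)
    tsum_enorm_sequenceCoord exists_sequenceCoord_eq fun s t hst i => ?_⟩
  filter_upwards [(memLp_sequenceCoord s i).coeFn_toLp, (memLp_sequenceCoord t i).coeFn_toLp]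
    with x hs ht
  change (memLp_sequenceCoord t i).toLp _ x = resolventSymbol x * (memLp_sequenceCoord s i).toLp _ x
  rw [hs, ht, hst]
  rfl

end SequenceField

end PaleyWiener

end

/-! ### The main theorem. -/

open MeasureTheory PaleyWiener
open scoped NNReal

universe u w v

theorem theorem1 {E : Type u} [NormedAddCommGroup E] [InnerProductSpace ℂ E]
    [CompleteSpace E] (D : E →ₗ.[ℂ] E) (hD : IsSelfAdjoint D)
    (hpos : ∀ x : D.domain, 0 ≤ (inner ℂ (D x) (x : E)).re) :
    -- `D` has a spectral representation
    (∃ (Ω : Type u) (_ : MeasurableSpace Ω) (μ : Measure Ω) (a : Ω → ℝ≥0),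
      Nonempty (SpectralRepresentation.{u, u, 0} D μ a)) ∧
    -- in a separable space there is one over the half-line `[0, ∞)`
    (TopologicalSpace.SeparableSpace E → ∃ m : Measure ℝ≥0, SigmaFinite m ∧
      Nonempty (SpectralRepresentation.{u, 0, 0} D m id)) ∧
    -- in every spectral representation, `f ∈ PW_ω(D)` iff `f` satisfies the Bernstein inequality
    ∀ {Ω : Type w} [MeasurableSpace Ω] (μ : Measure Ω) (a : Ω → ℝ≥0)
      (R : SpectralRepresentation.{u, w, v} D μ a) (ω : ℝ), 0 ≤ ω → ∀ f : E,
        f ∈ R.paleyWiener ω ↔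
          ∀ k : ℕ, ∃ hf : f ∈ (ppow D k).domain, ‖ppow D k ⟨f, hf⟩‖ ≤ ω ^ k * ‖f‖ := by
  obtain ⟨B, hB, hB1, hres⟩ := exists_isResolvent hD hpos
  obtain ⟨S, hS0, hSp, ν, V, hν, hV, hint⟩ :=
    exists_isHilbertSum_halfLine hB hB1 fun _ => hres.injective
  refine ⟨⟨_, _, _, _, exists_scalar_spectralRepresentation hres hV hint⟩, fun hsep => ?_,
    fun μ a R ω hω f => R.mem_paleyWiener_iff hω f⟩
  have hc : Countable S := (countable_of_pairwise_orthogonal hS0 hSp).to_subtype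
  -- `S` lives in the universe of `E`; its image in `ℕ` is an index type in `Type`, as needed for
  -- fibres in universe zero.
  obtain ⟨e, he⟩ := exists_injective_nat S
  let r : Set.range e ≃ S := (Equiv.ofInjective e he).symm
  exact exists_halfLine_spectralRepresentation (ν := fun i => ν (r i)) (V := fun i => V (r i)) hres
    (IsHilbertSum.of_range_eq hV r fun _ => rfl) fun i => hint (r i)
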